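/- Let $\mathcal L$ be the propositional language with binary connectives $\wedge,\vee,\cdot,\to$ and constants $0,1$; write $\neg\varphi$ for $\varphi\to 0$ and $\varphi\leftrightarrow\psi$ for $(\varphi\to\psi)\wedge(\psi\to\varphi)$. Let $I$ be a set of unary connectives with $\mathcal L\cap I=\emptyset$, let $\mathcal L(I)=\mathcal L\cup I$, and let formulas $Fm_{\mathcal L(I)}$ be built over a fixed countably infinite set of variables; the set $Eq_{\mathcal L(I)}$ of equations consists of the pairs $\epsilon\approx\delta$ of formulas. *Logics.* A logic is a substitution-invariant consequence relation $\vdash$ on $Fm_{\mathcal L(I)}$; it is finitary if $\Gamma\vdash\varphi$ implies $\Gamma_0\vdash\varphi$ for some finite $\Gamma_0\subseteq\Gamma$. The logic $\mathbf{Ł}(I)$ is given by the rules $\varphi,\varphi\to\psi\vdash\psi$ and $\varphi\vdash\Box\varphi$ ($\Box\in I$) and the axiom schemes $1$; $\varphi\to\varphi$; $(\varphi\to\psi)\to((\psi\to\chi)\to(\varphi\to\chi))$; $(\varphi\cdot\psi)\to(\psi\cdot\varphi)$; $(\varphi\cdot\psi)\to\psi$; $(\varphi\to(\psi\to\chi))\to((\varphi\cdot\psi)\to\chi)$;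 $((\varphi\cdot\psi)\to\chi)\to(\varphi\to(\psi\to\chi))$; $(\varphi\cdot(\varphi\to\psi))\to(\varphi\wedge\psi)$; $(\varphi\wedge\psi)\to(\varphi\cdot(\varphi\to\psi))$; $(\varphi\wedge\psi)\to(\psi\wedge\varphi)$; $\varphi\to(\varphi\vee\psi)$; $\psi\to(\varphi\vee\psi)$; $((\varphi\to\psi)\wedge(\chi\to\psi))\to((\varphi\vee\chi)\to\psi)$; $0\to\varphi$; $(\varphi\to\psi)\vee(\psi\to\varphi)$; $\neg\neg\varphi\leftrightarrow\varphi$; and, for all $\Box\in I$, $\Box(\varphi\to\psi)\to(\Box\varphi\to\Box\psi)$; $\Box(\varphi\cdot\psi)\leftrightarrow\Box\varphi\cdot\Box\psi$; $\Box(\varphi\wedge\psi)\leftrightarrow\Box\varphi\wedge\Box\psi$; $\Box1\leftrightarrow1$; $\Box0\leftrightarrow0$. An extension of $\mathbf{Ł}(I)$ is a logic in the same language whose consequence relation contains that of $\mathbf{Ł}(I)$; it is axiomatic if it is obtained from $\mathbf{Ł}(I)$ by adding all substitution instances of some set of formulas as axioms. The logic $\mathbf{S4Ł}(I)$ adds the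 schemes $\Box\varphi\to\varphi$ and $\Box\varphi\to\Box\Box\varphi$ for all $\Box\in I$; $\mathbf{S4Ł}$ is $\mathbf{S4Ł}(I)$ for a singleton $I$; and $\mathbf{S4_tŁ}$ is $\mathbf{S4Ł}(\{G,H\})$ with the additional schemes $\varphi\to G\neg H\neg\varphi$ and $\varphi\to H\neg G\neg\varphi$. *Algebras.* An MV-algebra is an algebra $(A,\wedge,\vee,\cdot,\to,0,1)$ such that $(A,\wedge,\vee,0,1)$ is a bounded lattice, $(A,\cdot,1)$ is a commutative monoid, $xy\le z\iff x\le y\to z$, $x(x\to y)=x\wedge y$, $(x\to y)\vee(y\to x)=1$ and $\neg\neg x=x$. The class $\mathsf{MV}(I)$ consists of the expansions of MV-algebras by a $\{\wedge,\cdot,0,1\}$-endomorphism $\Box$ for each $\Box\in I$; $\mathsf{S4MV}(I)$ consists of those members of $\mathsf{MV}(I)$ in which each $\Box$ is an interior operator; $\mathsf{S4MV}$ is the case of a singleton $I$; and $\mathsf{S4_tMV}$ consists of those members of $\mathsf{S4MV}(\{G,H\})$ in which $x\le G(y)\iff\neg H(\neg x)\le y$. A variety (quasivariety) is a class of algebras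 of type $\mathcal L(I)$ axiomatized by equations (by quasi-equations). For a class $\mathsf K$, $\Theta\models_{\mathsf K}\epsilon\approx\delta$ means that for all $\mathbf A\in\mathsf K$ and all assignments $h$ into $\mathbf A$, if $h(\alpha)=h(\beta)$ for all $\alpha\approx\beta\in\Theta$, then $h(\epsilon)=h(\delta)$. *Equivalent algebraic semantics.* A quasivariety $\mathsf K$ is an equivalent algebraic semantics of a logic $\mathbf L$ (in the sense of Blok and Pigozzi) if there are a finite set $\tau(p)$ of equations in one variable and a finite set $\Delta(p,q)$ of formulas in two variables such that, for all $\Gamma,\varphi,\Theta,\epsilon,\delta$: $\Gamma\vdash_{\mathbf L}\varphi\iff\tau(\Gamma)\models_{\mathsf K}\tau(\varphi)$; $\Theta\models_{\mathsf K}\epsilon\approx\delta\iff\Delta(\Theta)\vdash_{\mathbf L}\Delta(\epsilon,\delta)$; $\varphi$ and $\Delta(\tau(\varphi))$ are interderivable in $\mathbf L$; and $\epsilon\approx\delta$ and $\tau(\Delta(\epsilon,\delta))$ are equivalent with respect to $\models_{\mathsf K}$. **Statement.** Every finitary extension of $\mathbf{Ł}(I)$ has exactly one equivalent algebraic semantics.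 Sending a finitary extension to its equivalent algebraic semantics is a dual lattice isomorphism from the lattice of finitary extensions of $\mathbf{Ł}(I)$ onto the lattice of subquasivarieties of $\mathsf{MV}(I)$, and it restricts to a dual lattice isomorphism from the lattice of axiomatic extensions of $\mathbf{Ł}(I)$ onto the lattice of subvarieties of $\mathsf{MV}(I)$. Moreover, let $\mathbf L$ be a finitary extension of $\mathbf{Ł}(I)$ and $\mathsf K$ its equivalent algebraic semantics. Then for any $\Gamma\cup\{\varphi\}\subseteq Fm_{\mathcal L(I)}$ and any $\Theta\cup\{\epsilon\approx\delta\}\subseteq Eq_{\mathcal L(I)}$: 1. $\Gamma\vdash_{\mathbf L}\varphi\iff\{\gamma\approx1:\gamma\in\Gamma\}\models_{\mathsf K}\varphi\approx1$. 2. $\Theta\models_{\mathsf K}\epsilon\approx\delta\iff\{\alpha\leftrightarrow\beta:\alpha\approx\beta\in\Theta\}\vdash_{\mathbf L}\epsilon\leftrightarrow\delta$. In particular, this holds for $\mathbf L=\mathbf{Ł}(I),\mathbf{S4Ł}(I),\mathbf{S4Ł},\mathbf{S4_tŁ}$, whose equivalent algebraic semantics are $\mathsf{MV}(I),\mathsf{S4MV}(I),\mathsf{S4MV},\mathsf{S4_tMV}$,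 respectively. -/

import Mathlib

universe u v w

namespace ModalLukasiewicz

/-! ## Formulas, substitutions, algebras -/

/-- Formulas (= terms) of the language `L(I) = {∧, ∨, ·, →, 0, 1} ∪ I`, with variables in `V`. -/
inductive Formula (I : Type u) (V : Type v) : Type (max u v)
  | var (x : V)
  | meet (φ ψ : Formula I V)
  | join (φ ψ : Formula I V)
  | mul (φ ψ : Formula I V)
  | imp (φ ψ : Formula I V)
  | zero
  | one
  | box (i : I) (φ : Formula I V)

namespace Formula

variable {I : Type u} {V : Type v} {W : Type w}

/-- `¬φ` is `φ → 0`. -/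
def neg (φ : Formula I V) : Formula I V := φ.imp zero

/-- `φ ↔ ψ` is `(φ → ψ) ∧ (ψ → φ)`. -/
def iff (φ ψ : Formula I V) : Formula I V := (φ.imp ψ).meet (ψ.imp φ)

/-- Simultaneous substitution of formulas for variables. -/
def subst (s : V → Formula I W) : Formula I V → Formula I W
  | var x => s x
  | meet φ ψ => (φ.subst s).meet (ψ.subst s)
  | join φ ψ => (φ.subst s).join (ψ.subst s)
  | mul φ ψ => (φ.subst s).mul (ψ.subst s)
  | imp φ ψ => (φ.subst s).imp (ψ.subst s)
  | zero => zero
  | one => one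
  | box i φ => box i (φ.subst s)

theorem subst_subst {X : Type*} (s : V → Formula I W) (t : W → Formula I X) (φ : Formula I V) :
    (φ.subst s).subst t = φ.subst (fun x => (s x).subst t) := by
  induction φ <;> simp_all [subst]

theorem subst_var (φ : Formula I V) : φ.subst var = φ := by
  induction φ <;> simp_all [subst]

end Formula

/-- Formulas over the fixed countably infinite set of variables. -/
abbrev Fm (I : Type u) : Type u := Formula I ℕ

/-- Equations `φ ≈ ψ` are ordered pairs of formulas. -/
abbrev Eqn (I : Type u) : Type u := Fm I × Fm I

/-- Algebras of the type of `L(I)`. -/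
structure Alg (I : Type u) : Type (u + 1) where
  carrier : Type u
  meet : carrier → carrier → carrier
  join : carrier → carrier → carrier
  mul : carrier → carrier → carrier
  imp : carrier → carrier → carrier
  zero : carrier
  one : carrier
  box : I → carrier → carrier

namespace Alg

variable {I : Type u}

/-- The value of a formula in an algebra under an assignment of its variables. -/
def eval {V : Type v} (A : Alg I) (h : V → A.carrier) : Formula I V → A.carrier
  | .var x => h x
  | .meet φ ψ => A.meet (A.eval h φ) (A.eval h ψ)
  | .join φ ψ => A.join (A.eval h φ) (A.eval h ψ)
  | .mul φ ψ => A.mul (A.eval h φ) (A.eval h ψ)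
  | .imp φ ψ => A.imp (A.eval h φ) (A.eval h ψ)
  | .zero => A.zero
  | .one => A.one
  | .box i φ => A.box i (A.eval h φ)

/-- The lattice order: `x ≤ y` iff `x ∧ y = x`. -/
def le (A : Alg I) (x y : A.carrier) : Prop := A.meet x y = x

/-- `¬x = x → 0`. -/
def neg (A : Alg I) (x : A.carrier) : A.carrier := A.imp x A.zero

/-- Bounded commutative integral residuated lattices. -/
structure IsResiduatedLattice (A : Alg I) : Prop where
  meet_comm : ∀ x y, A.meet x y = A.meet y x
  meet_assoc : ∀ x y z, A.meet (A.meet x y) z = A.meet x (A.meet y z)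
  join_comm : ∀ x y, A.join x y = A.join y x
  join_assoc : ∀ x y z, A.join (A.join x y) z = A.join x (A.join y z)
  meet_join : ∀ x y, A.meet x (A.join x y) = x
  join_meet : ∀ x y, A.join x (A.meet x y) = x
  zero_le : ∀ x, A.le A.zero x
  le_one : ∀ x, A.le x A.one
  mul_comm : ∀ x y, A.mul x y = A.mul y x
  mul_assoc : ∀ x y z, A.mul (A.mul x y) z = A.mul x (A.mul y z)
  one_mul : ∀ x, A.mul A.one x = x
  residuation : ∀ x y z, A.le (A.mul x y) z ↔ A.le x (A.imp y z)

/-- GBL-algebras: residuated lattices with divisibility. -/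
structure IsGBL (A : Alg I) : Prop extends A.IsResiduatedLattice where
  divisibility : ∀ x y, A.mul x (A.imp x y) = A.meet x y

/-- BL-algebras: prelinear GBL-algebras. -/
structure IsBL (A : Alg I) : Prop extends A.IsGBL where
  prelinearity : ∀ x y, A.join (A.imp x y) (A.imp y x) = A.one

/-- The reduct without the modal operations is an MV-algebra: an involutive BL-algebra. -/
structure IsMV (A : Alg I) : Prop extends A.IsBL where
  neg_neg : ∀ x, A.neg (A.neg x) = x

/-- MV(I)-algebras. -/
structure IsMVI (A : Alg I) : Prop extends A.IsMV where
  box_meet : ∀ i x y, A.box i (A.meet x y) = A.meet (A.box i x) (A.box i y)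
  box_mul : ∀ i x y, A.box i (A.mul x y) = A.mul (A.box i x) (A.box i y)
  box_zero : ∀ i, A.box i A.zero = A.zero
  box_one : ∀ i, A.box i A.one = A.one

/-- S4MV(I)-algebras: every modal operation is an interior operator. -/
structure IsS4MVI (A : Alg I) : Prop extends A.IsMVI where
  box_mono : ∀ i x y, A.le x y → A.le (A.box i x) (A.box i y)
  box_le : ∀ i x, A.le (A.box i x) x
  box_box : ∀ i x, A.box i (A.box i x) = A.box i x

end Alg

/-- The two tense modalities. -/
inductive Tense : Type u
  | G
  | H

/-- S4ₜMV-algebras: `P = ¬H¬` is the lower residual of `G`. -/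
structure Alg.IsS4tMV (A : Alg Tense.{u}) : Prop extends A.IsS4MVI where
  residual : ∀ x y, A.le x (A.box .G y) ↔ A.le (A.neg (A.box .H (A.neg x))) y

/-- The class of MV(I)-algebras. -/
def MV (I : Type u) : Set (Alg I) := {A | A.IsMVI}

/-- The class of S4MV(I)-algebras. -/
def S4MV (I : Type u) : Set (Alg I) := {A | A.IsS4MVI}

/-- The class of S4ₜMV-algebras. -/
def S4tMV : Set (Alg Tense.{u}) := {A | A.IsS4tMV}

/-! ## Equational consequence, varieties, quasivarieties -/

section Classes

variable {I : Type u}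

/-- `Θ ⊨_K ε ≈ δ`, where `e = (ε, δ)`. -/
def EqConseq (K : Set (Alg I)) (Θ : Set (Eqn I)) (e : Eqn I) : Prop :=
  ∀ A ∈ K, ∀ h : ℕ → A.carrier,
    (∀ t ∈ Θ, A.eval h t.1 = A.eval h t.2) → A.eval h e.1 = A.eval h e.2

/-- Validity of an equation in an algebra. -/
def Alg.SatEqn (A : Alg I) (e : Eqn I) : Prop :=
  ∀ h : ℕ → A.carrier, A.eval h e.1 = A.eval h e.2

/-- Quasi-equations: a finite list of premises and a conclusion. -/
abbrev QuasiEqn (I : Type u) : Type u := List (Eqn I) × Eqn I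

/-- Validity of a quasi-equation in an algebra. -/
def Alg.SatQuasiEqn (A : Alg I) (q : QuasiEqn I) : Prop :=
  ∀ h : ℕ → A.carrier,
    (∀ t ∈ q.1, A.eval h t.1 = A.eval h t.2) → A.eval h q.2.1 = A.eval h q.2.2

/-- Varieties: the classes axiomatized by equations. -/
def IsVariety (K : Set (Alg I)) : Prop :=
  ∃ E : Set (Eqn I), K = {A | ∀ e ∈ E, A.SatEqn e}

/-- Quasivarieties: the classes axiomatized by quasi-equations. -/
def IsQuasivariety (K : Set (Alg I)) : Prop :=
  ∃ Q : Set (QuasiEqn I), K = {A | ∀ q ∈ Q, A.SatQuasiEqn q}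

theorem IsVariety.isQuasivariety {K : Set (Alg I)} (hK : IsVariety K) : IsQuasivariety K := by
  obtain ⟨E, rfl⟩ := hK
  refine ⟨(fun e => ([], e)) '' E, ?_⟩
  ext A
  constructor
  · rintro h _ ⟨e, he, rfl⟩ a -
    exact h e he a
  · intro h e he a
    exact h _ ⟨e, he, rfl⟩ a (by simp)

theorem IsVariety.inter_sInter {K : Set (Alg I)} (hK : IsVariety K) {S : Set (Set (Alg I))}
    (hS : ∀ X ∈ S, IsVariety X) : IsVariety (K ∩ ⋂₀ S) := by
  obtain ⟨E, rfl⟩ := hK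
  choose! F hF using hS
  refine ⟨E ∪ ⋃ X ∈ S, F X, ?_⟩
  ext A
  simp only [Set.mem_inter_iff, Set.mem_ofPred_eq, Set.mem_sInter, Set.mem_union, Set.mem_iUnion]
  constructor
  · rintro ⟨h1, h2⟩ e (he | ⟨X, hX, he⟩)
    · exact h1 e he
    · have := h2 X hX
      rw [hF X hX] at this
      exact this e he
  · intro h
    refine ⟨fun e he => h e (.inl he), fun X hX => ?_⟩
    rw [hF X hX]
    exact fun e he => h e (.inr ⟨X, hX, he⟩)

theorem IsQuasivariety.inter_sInter {K : Set (Alg I)} (hK : IsQuasivariety K)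
    {S : Set (Set (Alg I))} (hS : ∀ X ∈ S, IsQuasivariety X) : IsQuasivariety (K ∩ ⋂₀ S) := by
  obtain ⟨E, rfl⟩ := hK
  choose! F hF using hS
  refine ⟨E ∪ ⋃ X ∈ S, F X, ?_⟩
  ext A
  simp only [Set.mem_inter_iff, Set.mem_ofPred_eq, Set.mem_sInter, Set.mem_union, Set.mem_iUnion]
  constructor
  · rintro ⟨h1, h2⟩ e (he | ⟨X, hX, he⟩)
    · exact h1 e he
    · have := h2 X hX
      rw [hF X hX] at this
      exact this e he
  · intro h
    refine ⟨fun e he => h e (.inl he), fun X hX => ?_⟩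
    rw [hF X hX]
    exact fun e he => h e (.inr ⟨X, hX, he⟩)

namespace Alg.IsResiduatedLattice

variable {A : Alg I}

theorem le_refl (hA : A.IsResiduatedLattice) (x : A.carrier) : A.le x x := by
  have h := hA.meet_join x (A.meet x x)
  rwa [hA.join_meet] at h

theorem le_trans (hA : A.IsResiduatedLattice) {x y z : A.carrier} (h1 : A.le x y) (h2 : A.le y z) : A.le x z := by
  unfold Alg.le at *
  rw [← h1, hA.meet_assoc, h2]

theorem le_antisymm (hA : A.IsResiduatedLattice) {x y : A.carrier} (h1 : A.le x y) (h2 : A.le y x) : x = y := by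
  unfold Alg.le at *
  rw [← h1, hA.meet_comm, h2]

theorem meet_le_left (hA : A.IsResiduatedLattice) (x y : A.carrier) : A.le (A.meet x y) x := by
  unfold Alg.le
  rw [hA.meet_comm, ← hA.meet_assoc, hA.le_refl x]

theorem meet_le_right (hA : A.IsResiduatedLattice) (x y : A.carrier) : A.le (A.meet x y) y := by
  rw [hA.meet_comm]; exact hA.meet_le_left y x

theorem le_meet (hA : A.IsResiduatedLattice) {x y z : A.carrier} (h1 : A.le x y) (h2 : A.le x z) : A.le x (A.meet y z) := by
  unfold Alg.le at *
  rw [← hA.meet_assoc, h1, h2]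

theorem le_iff_join (hA : A.IsResiduatedLattice) {x y : A.carrier} : A.le x y ↔ A.join x y = y := by
  unfold Alg.le
  constructor
  · intro h
    rw [← h, hA.join_comm, hA.meet_comm, hA.join_meet]
  · intro h
    rw [← h, hA.meet_join]

theorem le_join_left (hA : A.IsResiduatedLattice) (x y : A.carrier) : A.le x (A.join x y) := hA.meet_join x y

theorem le_join_right (hA : A.IsResiduatedLattice) (x y : A.carrier) : A.le y (A.join x y) := by
  rw [hA.join_comm]; exact hA.le_join_left y x

theorem join_le (hA : A.IsResiduatedLattice) {x y z : A.carrier} (h1 : A.le x z) (h2 : A.le y z) : A.le (A.join x y) z := by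
  rw [hA.le_iff_join] at *
  rw [hA.join_assoc, h2, h1]

theorem mul_mono_left (hA : A.IsResiduatedLattice) {x y : A.carrier} (z : A.carrier) (h : A.le x y) :
    A.le (A.mul x z) (A.mul y z) :=
  (hA.residuation _ _ _).2 (hA.le_trans h ((hA.residuation _ _ _).1 (hA.le_refl _)))

theorem imp_mul_le (hA : A.IsResiduatedLattice) (x y : A.carrier) : A.le (A.mul (A.imp x y) x) y :=
  (hA.residuation _ _ _).2 (hA.le_refl _)

theorem imp_mono_right (hA : A.IsResiduatedLattice) {y z : A.carrier} (x : A.carrier) (h : A.le y z) :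
    A.le (A.imp x y) (A.imp x z) :=
  (hA.residuation _ _ _).1 (hA.le_trans (hA.imp_mul_le x y) h)

theorem join_mul (hA : A.IsResiduatedLattice) (x y z : A.carrier) :
    A.mul (A.join x y) z = A.join (A.mul x z) (A.mul y z) :=
  hA.le_antisymm
    ((hA.residuation _ _ _).2 (hA.join_le
      ((hA.residuation _ _ _).1 (hA.le_join_left _ _))
      ((hA.residuation _ _ _).1 (hA.le_join_right _ _))))
    (hA.join_le (hA.mul_mono_left z (hA.le_join_left _ _))
      (hA.mul_mono_left z (hA.le_join_right _ _)))

theorem imp_meet (hA : A.IsResiduatedLattice) (x y z : A.carrier) :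
    A.imp x (A.meet y z) = A.meet (A.imp x y) (A.imp x z) :=
  hA.le_antisymm
    (hA.le_meet (hA.imp_mono_right x (hA.meet_le_left _ _))
      (hA.imp_mono_right x (hA.meet_le_right _ _)))
    ((hA.residuation _ _ _).1 (hA.le_meet
      (hA.le_trans (hA.mul_mono_left x (hA.meet_le_left _ _)) (hA.imp_mul_le x y))
      (hA.le_trans (hA.mul_mono_left x (hA.meet_le_right _ _)) (hA.imp_mul_le x z))))

end Alg.IsResiduatedLattice

theorem isVariety_MV (I : Type u) : IsVariety (MV I) := by
  refine ⟨{e | ∀ A ∈ MV I, A.SatEqn e}, Set.Subset.antisymm (fun A hA e he => he A hA) ?_⟩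
  intro A hA
  let a (x y z : A.carrier) : ℕ → A.carrier := fun n => if n = 0 then x else if n = 1 then y else z
  let X : Fm I := .var 0
  let Y : Fm I := .var 1
  let Z : Fm I := .var 2
  have meet_comm (x y) : A.meet x y = A.meet y x :=
    hA (X.meet Y, Y.meet X) (fun B hB h => hB.meet_comm _ _) (a x y y)
  have meet_assoc (x y z) : A.meet (A.meet x y) z = A.meet x (A.meet y z) :=
    hA ((X.meet Y).meet Z, X.meet (Y.meet Z)) (fun B hB h => hB.meet_assoc _ _ _) (a x y z)
  have join_comm (x y) : A.join x y = A.join y x :=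
    hA (X.join Y, Y.join X) (fun B hB h => hB.join_comm _ _) (a x y y)
  have join_assoc (x y z) : A.join (A.join x y) z = A.join x (A.join y z) :=
    hA ((X.join Y).join Z, X.join (Y.join Z)) (fun B hB h => hB.join_assoc _ _ _) (a x y z)
  have meet_join (x y) : A.meet x (A.join x y) = x :=
    hA (X.meet (X.join Y), X) (fun B hB h => hB.meet_join _ _) (a x y y)
  have join_meet (x y) : A.join x (A.meet x y) = x :=
    hA (X.join (X.meet Y), X) (fun B hB h => hB.join_meet _ _) (a x y y)
  have join_mul (x y z) : A.mul (A.join x y) z = A.join (A.mul x z) (A.mul y z) :=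
    hA ((X.join Y).mul Z, (X.mul Z).join (Y.mul Z))
      (fun B hB h => hB.toIsResiduatedLattice.join_mul _ _ _) (a x y z)
  have imp_meet (x y z) : A.imp x (A.meet y z) = A.meet (A.imp x y) (A.imp x z) :=
    hA (X.imp (Y.meet Z), (X.imp Y).meet (X.imp Z))
      (fun B hB h => hB.toIsResiduatedLattice.imp_meet _ _ _) (a x y z)
  have imp_mul_le (x y) : A.meet (A.mul (A.imp x y) x) y = A.mul (A.imp x y) x :=
    hA (((X.imp Y).mul X).meet Y, (X.imp Y).mul X)
      (fun B hB h => hB.toIsResiduatedLattice.imp_mul_le _ _) (a x y y)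
  have le_imp_mul (x y) : A.meet x (A.imp y (A.mul x y)) = x :=
    hA (X.meet (Y.imp (X.mul Y)), X)
      (fun B hB h => (hB.residuation _ _ _).1 (hB.toIsResiduatedLattice.le_refl _)) (a x y y)
  have hmj (x y) : A.meet x y = x ↔ A.join x y = y :=
    ⟨fun h => by rw [← h, join_comm, meet_comm, join_meet], fun h => by rw [← h, meet_join]⟩
  refine
    { meet_comm := meet_comm
      meet_assoc := meet_assoc
      join_comm := join_comm
      join_assoc := join_assoc
      meet_join := meet_join
      join_meet := join_meet
      zero_le := fun x => hA (Formula.zero.meet X, Formula.zero) (fun B hB h => hB.zero_le _) (a x x x)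
      le_one := fun x => hA (X.meet Formula.one, X) (fun B hB h => hB.le_one _) (a x x x)
      mul_comm := fun x y => hA (X.mul Y, Y.mul X) (fun B hB h => hB.mul_comm _ _) (a x y y)
      mul_assoc := fun x y z => hA ((X.mul Y).mul Z, X.mul (Y.mul Z))
        (fun B hB h => hB.mul_assoc _ _ _) (a x y z)
      one_mul := fun x => hA (Formula.one.mul X, X) (fun B hB h => hB.one_mul _) (a x x x)
      residuation := ?_
      divisibility := fun x y => hA (X.mul (X.imp Y), X.meet Y)
        (fun B hB h => hB.divisibility _ _) (a x y y)
      prelinearity := fun x y => hA ((X.imp Y).join (Y.imp X), Formula.one)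
        (fun B hB h => hB.prelinearity _ _) (a x y y)
      neg_neg := fun x => hA (X.neg.neg, X) (fun B hB h => hB.neg_neg _) (a x x x)
      box_meet := fun i x y => hA ((X.meet Y).box i, (X.box i).meet (Y.box i))
        (fun B hB h => hB.box_meet _ _ _) (a x y y)
      box_mul := fun i x y => hA ((X.mul Y).box i, (X.box i).mul (Y.box i))
        (fun B hB h => hB.box_mul _ _ _) (a x y y)
      box_zero := fun i => hA (Formula.zero.box i, Formula.zero)
        (fun B hB h => hB.box_zero _) (a A.zero A.zero A.zero)
      box_one := fun i => hA (Formula.one.box i, Formula.one)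
        (fun B hB h => hB.box_one _) (a A.zero A.zero A.zero) }
  intro x y z
  unfold Alg.le
  constructor
  · intro h
    have h1 : A.meet (A.imp y (A.mul x y)) (A.imp y z) = A.imp y (A.mul x y) := by
      rw [← imp_meet, h]
    have h2 := le_imp_mul x y
    rw [← h2, meet_assoc, h1]
  · intro h
    have h1 : A.join (A.mul x y) (A.mul (A.imp y z) y) = A.mul (A.imp y z) y := by
      rw [← join_mul, (hmj _ _).1 h]
    rw [← hmj] at h1
    have h2 := imp_mul_le y z
    rw [← h1, meet_assoc, h2]

end Classes

/-- Subquasivarieties of the class of MV(I)-algebras, ordered by inclusion. -/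
def SubQuasivariety (I : Type u) : Type (u + 1) :=
  {K : Set (Alg I) // IsQuasivariety K ∧ K ⊆ MV I}

/-- Subvarieties of the class of MV(I)-algebras, ordered by inclusion. -/
def SubVariety (I : Type u) : Type (u + 1) :=
  {K : Set (Alg I) // IsVariety K ∧ K ⊆ MV I}

instance (I : Type u) : PartialOrder (SubQuasivariety I) :=
  inferInstanceAs (PartialOrder {K : Set (Alg I) // IsQuasivariety K ∧ K ⊆ MV I})

instance (I : Type u) : PartialOrder (SubVariety I) :=
  inferInstanceAs (PartialOrder {K : Set (Alg I) // IsVariety K ∧ K ⊆ MV I})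

/-- Meets of subquasivarieties are intersections (within `MV I`). -/
instance (I : Type u) : InfSet (SubQuasivariety I) where
  sInf S := ⟨MV I ∩ ⋂₀ (Subtype.val '' S),
    (isVariety_MV I).isQuasivariety.inter_sInter (by rintro _ ⟨K, -, rfl⟩; exact K.2.1),
    Set.inter_subset_left⟩

/-- Meets of subvarieties are intersections (within `MV I`). -/
instance (I : Type u) : InfSet (SubVariety I) where
  sInf S := ⟨MV I ∩ ⋂₀ (Subtype.val '' S),
    (isVariety_MV I).inter_sInter (by rintro _ ⟨K, -, rfl⟩; exact K.2.1),
    Set.inter_subset_left⟩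

/-- The lattice of subquasivarieties. -/
instance (I : Type u) : CompleteLattice (SubQuasivariety I) :=
  completeLatticeOfInf _ fun S =>
    ⟨fun K hK => Set.inter_subset_right.trans (Set.sInter_subset_of_mem ⟨K, hK, rfl⟩),
      fun K hK => Set.subset_inter K.2.2
        (Set.subset_sInter (by rintro _ ⟨M, hM, rfl⟩; exact hK hM))⟩

/-- The lattice of subvarieties. -/
instance (I : Type u) : CompleteLattice (SubVariety I) :=
  completeLatticeOfInf _ fun S =>
    ⟨fun K hK => Set.inter_subset_right.trans (Set.sInter_subset_of_mem ⟨K, hK, rfl⟩),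
      fun K hK => Set.subset_inter K.2.2
        (Set.subset_sInter (by rintro _ ⟨M, hM, rfl⟩; exact hK hM))⟩

/-! ## Logics and Hilbert calculi -/

/-- A logic in the language `L(I)`: a substitution-invariant consequence relation. -/
@[ext] structure Logic (I : Type u) : Type u where
  Entails : Set (Fm I) → Fm I → Prop
  refl : ∀ {Γ φ}, φ ∈ Γ → Entails Γ φ
  mono : ∀ {Γ Δ φ}, Γ ⊆ Δ → Entails Γ φ → Entails Δ φ
  cut : ∀ {Γ Δ φ}, (∀ ψ ∈ Δ, Entails Γ ψ) → Entails Δ φ → Entails Γ φ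
  structural : ∀ {Γ φ} (s : ℕ → Fm I), Entails Γ φ → Entails (Formula.subst s '' Γ) (φ.subst s)

namespace Logic

variable {I : Type u}

/-- `L ≤ M` when `M` is an extension of `L`. -/
instance : PartialOrder (Logic I) where
  le L M := ∀ Γ φ, L.Entails Γ φ → M.Entails Γ φ
  le_refl _ _ _ h := h
  le_trans _ _ _ h1 h2 Γ φ h := h2 Γ φ (h1 Γ φ h)
  le_antisymm L M h1 h2 := by
    ext Γ φ
    exact ⟨h1 Γ φ, h2 Γ φ⟩

/-- Finitarity of a logic. -/
def IsFinitary (L : Logic I) : Prop :=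
  ∀ Γ φ, L.Entails Γ φ → ∃ Γ₀ ⊆ Γ, Γ₀.Finite ∧ L.Entails Γ₀ φ

end Logic

section Calculi

variable {I : Type u}

/-- Derivability from `Γ` in the Hilbert calculus with axioms `Ax` and the rules
modus ponens and necessitation for every `□ ∈ I`. -/
inductive Derives (Ax : Set (Fm I)) (Γ : Set (Fm I)) : Fm I → Prop
  | ax {φ} : φ ∈ Ax → Derives Ax Γ φ
  | hyp {φ} : φ ∈ Γ → Derives Ax Γ φ
  | mp {φ ψ} : Derives Ax Γ φ → Derives Ax Γ (φ.imp ψ) → Derives Ax Γ ψ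
  | nec (i : I) {φ} : Derives Ax Γ φ → Derives Ax Γ (φ.box i)

theorem Derives.mono {Ax Γ Δ : Set (Fm I)} (h : Γ ⊆ Δ) {φ} (d : Derives Ax Γ φ) :
    Derives Ax Δ φ := by
  induction d with
  | ax h1 => exact .ax h1
  | hyp h1 => exact .hyp (h h1)
  | mp _ _ h1 h2 => exact .mp h1 h2
  | nec i _ h1 => exact .nec i h1

theorem Derives.finitary {Ax Γ : Set (Fm I)} {φ} (d : Derives Ax Γ φ) :
    ∃ Γ₀ ⊆ Γ, Γ₀.Finite ∧ Derives Ax Γ₀ φ := by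
  induction d with
  | ax h1 => exact ⟨∅, Set.empty_subset _, Set.finite_empty, .ax h1⟩
  | @hyp φ h1 => exact ⟨{φ}, by simpa using h1, Set.finite_singleton _, .hyp rfl⟩
  | mp _ _ h1 h2 =>
    obtain ⟨A, hA, fA, dA⟩ := h1
    obtain ⟨B, hB, fB, dB⟩ := h2
    exact ⟨A ∪ B, Set.union_subset hA hB, fA.union fB,
      .mp (dA.mono Set.subset_union_left) (dB.mono Set.subset_union_right)⟩
  | nec i _ h1 =>
    obtain ⟨A, hA, fA, dA⟩ := h1
    exact ⟨A, hA, fA, .nec i dA⟩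

/-- The axioms are given by schemes: they are closed under substitution. -/
def SubstClosed (Ax : Set (Fm I)) : Prop := ∀ s : ℕ → Fm I, ∀ φ ∈ Ax, φ.subst s ∈ Ax

/-- The logic of the Hilbert calculus with axioms `Ax`, modus ponens and necessitation. -/
def hilbert (Ax : Set (Fm I)) (hAx : SubstClosed Ax) : Logic I where
  Entails := Derives Ax
  refl h := .hyp h
  mono h d := d.mono h
  cut h d := by
    induction d with
    | ax h1 => exact .ax h1
    | hyp h1 => exact h _ h1
    | mp _ _ h1 h2 => exact .mp h1 h2
    | nec i _ h1 => exact .nec i h1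
  structural s d := by
    induction d with
    | ax h1 => exact .ax (hAx s _ h1)
    | hyp h1 => exact .hyp ⟨_, h1, rfl⟩
    | mp _ _ h1 h2 => exact .mp h1 h2
    | nec i _ h1 => exact .nec i h1

theorem hilbert_isFinitary (Ax : Set (Fm I)) (hAx : SubstClosed Ax) :
    (hilbert Ax hAx).IsFinitary := fun _ _ d => d.finitary

theorem hilbert_mono {Ax Bx : Set (Fm I)} (hA : SubstClosed Ax) (hB : SubstClosed Bx)
    (h : Ax ⊆ Bx) : hilbert Ax hA ≤ hilbert Bx hB := by
  intro Γ φ d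
  change Derives Bx Γ φ
  induction d with
  | ax h1 => exact .ax (h h1)
  | hyp h1 => exact .hyp h1
  | mp _ _ h1 h2 => exact .mp h1 h2
  | nec i _ h1 => exact .nec i h1

/-- All substitution instances of the formulas in `S`. -/
def instances (S : Set (Fm I)) : Set (Fm I) := {φ | ∃ ψ ∈ S, ∃ s : ℕ → Fm I, φ = ψ.subst s}

theorem substClosed_instances (S : Set (Fm I)) : SubstClosed (instances S) := by
  rintro s _ ⟨ψ, hψ, t, rfl⟩
  exact ⟨ψ, hψ, _, Formula.subst_subst t s ψ⟩

theorem SubstClosed.union {A B : Set (Fm I)} (hA : SubstClosed A) (hB : SubstClosed B) :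
    SubstClosed (A ∪ B) := by
  rintro s φ (h | h)
  · exact .inl (hA s φ h)
  · exact .inr (hB s φ h)

/-- The axiom schemes of the modal Łukasiewicz logic Ł(I). The scheme `top` says that the constant
`1` is a theorem. -/
inductive LukAxiom : Fm I → Prop
  | top : LukAxiom .one
  | a1 (φ : Fm I) : LukAxiom (φ.imp φ)
  | a2 (φ ψ χ : Fm I) : LukAxiom ((φ.imp ψ).imp ((ψ.imp χ).imp (φ.imp χ)))
  | a3 (φ ψ : Fm I) : LukAxiom ((φ.mul ψ).imp (ψ.mul φ))
  | a4 (φ ψ : Fm I) : LukAxiom ((φ.mul ψ).imp ψ)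
  | a5 (φ ψ χ : Fm I) : LukAxiom ((φ.imp (ψ.imp χ)).imp ((φ.mul ψ).imp χ))
  | a6 (φ ψ χ : Fm I) : LukAxiom (((φ.mul ψ).imp χ).imp (φ.imp (ψ.imp χ)))
  | a7 (φ ψ : Fm I) : LukAxiom ((φ.mul (φ.imp ψ)).imp (φ.meet ψ))
  | a8 (φ ψ : Fm I) : LukAxiom ((φ.meet ψ).imp (φ.mul (φ.imp ψ)))
  | a9 (φ ψ : Fm I) : LukAxiom ((φ.meet ψ).imp (ψ.meet φ))
  | a10 (φ ψ : Fm I) : LukAxiom (φ.imp (φ.join ψ))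
  | a11 (φ ψ : Fm I) : LukAxiom (ψ.imp (φ.join ψ))
  | a12 (φ ψ χ : Fm I) : LukAxiom (((φ.imp ψ).meet (χ.imp ψ)).imp ((φ.join χ).imp ψ))
  | a13 (φ : Fm I) : LukAxiom (Formula.zero.imp φ)
  | a14 (φ ψ : Fm I) : LukAxiom ((φ.imp ψ).join (ψ.imp φ))
  | a15 (φ : Fm I) : LukAxiom (φ.neg.neg.iff φ)
  | boxK (i : I) (φ ψ : Fm I) : LukAxiom (((φ.imp ψ).box i).imp ((φ.box i).imp (ψ.box i)))
  | boxP (i : I) (φ ψ : Fm I) : LukAxiom (((φ.mul ψ).box i).iff ((φ.box i).mul (ψ.box i)))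
  | boxM (i : I) (φ ψ : Fm I) : LukAxiom (((φ.meet ψ).box i).iff ((φ.box i).meet (ψ.box i)))
  | boxOne (i : I) : LukAxiom ((Formula.one.box i).iff .one)
  | boxZero (i : I) : LukAxiom ((Formula.zero.box i).iff .zero)

/-- The axiom schemes `□φ → φ` and `□φ → □□φ`, for every `□ ∈ I`. -/
inductive S4Axiom : Fm I → Prop
  | boxT (i : I) (φ : Fm I) : S4Axiom ((φ.box i).imp φ)
  | box4 (i : I) (φ : Fm I) : S4Axiom ((φ.box i).imp ((φ.box i).box i))

/-- The axiom schemes `φ → G¬H¬φ` and `φ → H¬G¬φ`. -/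
inductive TenseAxiom : Fm Tense.{u} → Prop
  | gp (φ : Fm Tense.{u}) : TenseAxiom (φ.imp ((φ.neg.box .H).neg.box .G))
  | hf (φ : Fm Tense.{u}) : TenseAxiom (φ.imp ((φ.neg.box .G).neg.box .H))

theorem substClosed_luk : SubstClosed {φ : Fm I | LukAxiom φ} := by
  rintro s φ h
  cases h <;> constructor

theorem substClosed_s4 : SubstClosed {φ : Fm I | S4Axiom φ} := by
  rintro s φ h
  cases h <;> constructor

theorem substClosed_tense : SubstClosed {φ : Fm Tense.{u} | TenseAxiom φ} := by
  rintro s φ h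
  cases h <;> constructor

end Calculi

/-- The logic Ł(I). -/
def Luk (I : Type u) : Logic I := hilbert {φ | LukAxiom φ} substClosed_luk

/-- Finitary extensions of Ł(I), ordered by extension. -/
def FinExt (I : Type u) : Type u := {L : Logic I // L.IsFinitary ∧ Luk I ≤ L}

/-- The extension of Ł(I) by all substitution instances of the formulas in `S` as new axioms. -/
def axiomaticExt {I : Type u} (S : Set (Fm I)) : Logic I :=
  hilbert ({φ | LukAxiom φ} ∪ instances S) (substClosed_luk.union (substClosed_instances S))

/-- Axiomatic extensions of Ł(I), ordered by extension. -/
def AxExt (I : Type u) : Type u := {L : Logic I // ∃ S : Set (Fm I), L = axiomaticExt S}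

instance (I : Type u) : PartialOrder (FinExt I) :=
  inferInstanceAs (PartialOrder {L : Logic I // L.IsFinitary ∧ Luk I ≤ L})

instance (I : Type u) : PartialOrder (AxExt I) :=
  inferInstanceAs (PartialOrder {L : Logic I // ∃ S : Set (Fm I), L = axiomaticExt S})

theorem luk_le_axiomaticExt {I : Type u} (S : Set (Fm I)) : Luk I ≤ axiomaticExt S :=
  hilbert_mono _ _ Set.subset_union_left

theorem axiomaticExt_isFinitary {I : Type u} (S : Set (Fm I)) : (axiomaticExt S).IsFinitary :=
  hilbert_isFinitary _ _

/-- Every axiomatic extension is a finitary extension. -/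
def AxExt.toFinExt {I : Type u} (L : AxExt I) : FinExt I :=
  ⟨L.1, by
    obtain ⟨L, S, rfl⟩ := L
    exact ⟨axiomaticExt_isFinitary S, luk_le_axiomaticExt S⟩⟩

/-- The meet of a family of finitary extensions is the finitary part of the intersection. -/
instance (I : Type u) : InfSet (FinExt I) where
  sInf S :=
    ⟨{ Entails := fun Γ φ => ∃ Γ₀ ⊆ Γ, Γ₀.Finite ∧ ∀ L ∈ S, L.1.Entails Γ₀ φ
       refl := fun {Γ φ} h =>
        ⟨{φ}, by simpa using h, Set.finite_singleton _, fun L _ => L.1.refl rfl⟩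
       mono := fun h ⟨Γ₀, h1, h2, h3⟩ => ⟨Γ₀, h1.trans h, h2, h3⟩
       cut := by
        rintro Γ Δ φ h ⟨Δ₀, h1, h2, h3⟩
        choose! f hf1 hf2 hf3 using h
        refine ⟨⋃ ψ ∈ Δ₀, f ψ, Set.iUnion₂_subset fun ψ hψ => hf1 ψ (h1 hψ),
          h2.biUnion fun ψ hψ => hf2 ψ (h1 hψ), fun L hL => L.1.cut (fun ψ hψ => ?_) (h3 L hL)⟩
        exact L.1.mono (Set.subset_biUnion_of_mem hψ) (hf3 ψ (h1 hψ) L hL)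
       structural := by
        rintro Γ φ s ⟨Γ₀, h1, h2, h3⟩
        exact ⟨_, Set.image_mono h1, h2.image _, fun L hL => L.1.structural s (h3 L hL)⟩ },
      fun _ _ ⟨Γ₀, h1, h2, h3⟩ => ⟨Γ₀, h1, h2, Γ₀, subset_rfl, h2, h3⟩,
      fun Γ φ d => by
        obtain ⟨Γ₀, h1, h2, h3⟩ := Derives.finitary d
        exact ⟨Γ₀, h1, h2, fun L _ => L.2.2 _ _ h3⟩⟩

/-- The lattice of finitary extensions. -/
instance (I : Type u) : CompleteLattice (FinExt I) :=
  completeLatticeOfInf _ fun S =>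
    ⟨fun L hL _ _ ⟨_, h1, _, h3⟩ => L.1.mono h1 (h3 L hL), fun M hM Γ φ d => by
      obtain ⟨Γ₀, h1, h2, h3⟩ := M.2.1 Γ φ d
      exact ⟨Γ₀, h1, h2, fun L hL => hM hL _ _ h3⟩⟩

/-- The join of a family of axiomatic extensions is axiomatized by all their theorems. -/
instance (I : Type u) : SupSet (AxExt I) where
  sSup S := ⟨axiomaticExt {φ | ∃ L ∈ S, L.1.Entails ∅ φ}, _, rfl⟩

/-- The lattice of axiomatic extensions. -/
instance (I : Type u) : CompleteLattice (AxExt I) :=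
  completeLatticeOfSup _ fun S => by
    constructor
    · rintro ⟨L, T, rfl⟩ hL
      refine hilbert_mono (substClosed_luk.union (substClosed_instances _))
        (substClosed_luk.union (substClosed_instances _)) (Set.union_subset_union_right _ ?_)
      rintro φ h
      refine ⟨φ, ⟨_, hL, .ax (.inr h)⟩, Formula.var, (Formula.subst_var φ).symm⟩
    · rintro ⟨M, T, rfl⟩ hM Γ φ d
      change Derives _ Γ φ
      induction d with
      | ax h1 =>
        rcases h1 with h1 | ⟨ψ, ⟨L, hL, h2⟩, s, rfl⟩
        · exact .ax (.inl h1)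
        · have h3 := (axiomaticExt T).structural s (hM hL _ _ h2)
          rw [Set.image_empty] at h3
          exact Derives.mono (Set.empty_subset _) h3
      | hyp h1 => exact .hyp h1
      | mp _ _ h1 h2 => exact .mp h1 h2
      | nec i _ h1 => exact .nec i h1

/-- Ł(I) as a finitary extension of itself. -/
def lukExt (I : Type u) : FinExt I := ⟨Luk I, hilbert_isFinitary _ _, le_rfl⟩

/-- The logic S4Ł(I). -/
def s4Luk (I : Type u) : FinExt I :=
  ⟨hilbert ({φ | LukAxiom φ} ∪ {φ | S4Axiom φ}) (substClosed_luk.union substClosed_s4),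
    hilbert_isFinitary _ _, hilbert_mono _ _ Set.subset_union_left⟩

/-- The logic S4ₜŁ. -/
def s4tLuk : FinExt Tense.{u} :=
  ⟨hilbert ({φ | LukAxiom φ} ∪ {φ | S4Axiom φ} ∪ {φ | TenseAxiom φ})
      ((substClosed_luk.union substClosed_s4).union substClosed_tense),
    hilbert_isFinitary _ _,
    hilbert_mono _ _ (Set.subset_union_left.trans Set.subset_union_left)⟩

/-! ## Algebraizability -/

section Algebraizability

variable {I : Type u}

/-- The equations `τ(Γ)`, where `τ = τ(p)` is a set of equations in one variable. -/
def toEqns (τ : Set (Formula I (Fin 1) × Formula I (Fin 1))) (Γ : Set (Fm I)) : Set (Eqn I) :=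
  {e | ∃ γ ∈ Γ, ∃ t ∈ τ, e = (t.1.subst ![γ], t.2.subst ![γ])}

/-- The formulas `Δ(Θ)`, where `Δ = Δ(p, q)` is a set of formulas in two variables. -/
def toFms (Δ : Set (Formula I (Fin 2))) (Θ : Set (Eqn I)) : Set (Fm I) :=
  {φ | ∃ t ∈ Θ, ∃ d ∈ Δ, φ = d.subst ![t.1, t.2]}

/-- `K` is an equivalent algebraic semantics of `L` in the sense of Blok and Pigozzi: a
quasivariety such that, for some finite sets `τ` of defining equations and `Δ` of equivalence
formulas, the induced translations interpret the two consequence relations in each other and are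
mutually inverse up to interderivability. -/
def IsEquivAlgSem (L : Logic I) (K : Set (Alg I)) : Prop :=
  IsQuasivariety K ∧
    ∃ (τ : Set (Formula I (Fin 1) × Formula I (Fin 1))) (Δ : Set (Formula I (Fin 2))),
      τ.Finite ∧ Δ.Finite ∧
      (∀ Γ φ, L.Entails Γ φ ↔ ∀ e ∈ toEqns τ {φ}, EqConseq K (toEqns τ Γ) e) ∧
      (∀ Θ e, EqConseq K Θ e ↔ ∀ ψ ∈ toFms Δ {e}, L.Entails (toFms Δ Θ) ψ) ∧
      (∀ φ, (∀ ψ ∈ toFms Δ (toEqns τ {φ}), L.Entails {φ} ψ) ∧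
        L.Entails (toFms Δ (toEqns τ {φ})) φ) ∧
      (∀ e, (∀ e' ∈ toEqns τ (toFms Δ {e}), EqConseq K {e} e') ∧
        EqConseq K (toEqns τ (toFms Δ {e})) e)

/-- The correspondence between derivability in `L` and equational consequence in `K` under the
translations `φ ↦ φ ≈ 1` and `α ≈ β ↦ α ↔ β`. -/
def Corresponds (L : Logic I) (K : Set (Alg I)) : Prop :=
  (∀ (Γ : Set (Fm I)) (φ : Fm I),
    L.Entails Γ φ ↔ EqConseq K {e | ∃ γ ∈ Γ, e = (γ, .one)} (φ, .one)) ∧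
  (∀ (Θ : Set (Eqn I)) (ε δ : Fm I),
    EqConseq K Θ (ε, δ) ↔ L.Entails {φ | ∃ t ∈ Θ, φ = t.1.iff t.2} (ε.iff δ))

end Algebraizability

end ModalLukasiewicz

open ModalLukasiewicz

-- The defining equation is p ≈ 1 and the equivalence formula is p ↔ q. In a residuated lattice x →
-- y = 1 means x ≤ y, so x ↔ y = 1 means x = y (`iff_eq_one`), and over MV(I) equations and formulas
-- carry the same information.
--
-- To a logic L is attached the class `models L` of MV(I)-algebras in which the finite rules of L
-- preserve the value 1. For finitary L soundness is immediate. Completeness (`entails_iff_models`)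
-- comes from the Lindenbaum algebra of the theory generated by Γ. It is an MV(I)-algebra
-- (`lindenbaum_isMVI`); an assignment into it is a substitution, so structurality of L makes it a
-- model; and the formulas whose class is 1 are exactly the consequences of Γ.
--
-- A quasivariety is determined by its equational consequences from finitely many premises. For any
-- other choice of τ and Δ, Δ(ε, δ) is interderivable with ε ↔ δ, which forces the same equational
-- consequence and hence the same class (`IsEquivAlgSem.eq_models`).
--
-- By completeness, L ↦ `models L` reverses and reflects order. It is onto because a quasi-equation
-- has finitely many premises and so translates into a finitary rule (`models_logicOf`). An order
-- isomorphism preserves all lattice operations. Modus ponens and necessitation preserve 1 in every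
-- MV(I)-algebra, so for a Hilbert calculus only the axioms restrict the models (`models_hilbert`).
-- Hence axiomatic extensions give varieties, every subvariety arises by turning its equations into
-- axioms ε ↔ δ, and the named logics are settled by reading their axioms algebraically.

namespace ModalLukasiewicz

variable {I : Type u}

/-! ## MV(I)-algebras -/

namespace Alg

variable {A : Alg I}

theorem eval_subst {V : Type v} {W : Type w} (A : Alg I) (h : W → A.carrier)
    (s : V → Formula I W) (φ : Formula I V) :
    A.eval h (φ.subst s) = A.eval (fun x => A.eval h (s x)) φ := by
  induction φ <;> simp_all [Formula.subst, eval]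

namespace IsResiduatedLattice

theorem le_of_eq (hA : A.IsResiduatedLattice) {x y : A.carrier} (h : x = y) : A.le x y :=
  h ▸ hA.le_refl x

theorem imp_eq_one (hA : A.IsResiduatedLattice) {x y : A.carrier} :
    A.imp x y = A.one ↔ A.le x y := by
  constructor
  · intro h
    have h1 : A.le A.one (A.imp x y) := h ▸ hA.le_refl _
    have h2 := (hA.residuation _ _ _).2 h1
    rwa [hA.one_mul] at h2
  · intro h
    refine hA.le_antisymm (hA.le_one _) ((hA.residuation _ _ _).1 ?_)
    rwa [hA.one_mul]

theorem meet_eq_one (hA : A.IsResiduatedLattice) {x y : A.carrier} :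
    A.meet x y = A.one ↔ x = A.one ∧ y = A.one := by
  constructor
  · intro h
    exact ⟨hA.le_antisymm (hA.le_one _) (h ▸ hA.meet_le_left x y),
      hA.le_antisymm (hA.le_one _) (h ▸ hA.meet_le_right x y)⟩
  · rintro ⟨rfl, rfl⟩
    exact hA.le_refl _

theorem iff_eq_one (hA : A.IsResiduatedLattice) {x y : A.carrier} :
    A.meet (A.imp x y) (A.imp y x) = A.one ↔ x = y := by
  rw [hA.meet_eq_one, hA.imp_eq_one, hA.imp_eq_one]
  exact ⟨fun h => hA.le_antisymm h.1 h.2, by rintro rfl; exact ⟨hA.le_refl _, hA.le_refl _⟩⟩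

theorem eval_iff (hA : A.IsResiduatedLattice) {V : Type v} (h : V → A.carrier)
    (φ ψ : Formula I V) : A.eval h (φ.iff ψ) = A.one ↔ A.eval h φ = A.eval h ψ :=
  hA.iff_eq_one

theorem mul_le_right (hA : A.IsResiduatedLattice) (x y : A.carrier) : A.le (A.mul x y) y := by
  have h := hA.mul_mono_left y (hA.le_one x)
  rwa [hA.one_mul] at h

theorem imp_imp (hA : A.IsResiduatedLattice) (x y z : A.carrier) :
    A.imp x (A.imp y z) = A.imp (A.mul x y) z := by
  apply hA.le_antisymm
  · rw [← hA.residuation, ← hA.mul_assoc, hA.residuation, hA.residuation]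
    exact hA.le_refl _
  · rw [← hA.residuation, ← hA.residuation, hA.mul_assoc, hA.residuation]
    exact hA.le_refl _

theorem imp_anti_left (hA : A.IsResiduatedLattice) {x y : A.carrier} (z : A.carrier)
    (h : A.le x y) : A.le (A.imp y z) (A.imp x z) := by
  rw [← hA.residuation, hA.mul_comm]
  exact hA.le_trans (hA.mul_mono_left _ h) (hA.mul_comm _ _ ▸ hA.imp_mul_le y z)

end IsResiduatedLattice

-- Soundness of the calculus in MV(I)-algebras

theorem IsMVI.box_mono (hA : A.IsMVI) (i : I) {x y : A.carrier} (h : A.le x y) :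
    A.le (A.box i x) (A.box i y) := by
  unfold le at *
  rw [← hA.box_meet, h]

theorem IsMVI.eval_lukAxiom (hA : A.IsMVI) {φ : Fm I} (hφ : LukAxiom φ) (h : ℕ → A.carrier) :
    A.eval h φ = A.one := by
  have R := hA.toIsResiduatedLattice
  cases hφ with
  | top => rfl
  | a1 φ => exact R.imp_eq_one.2 (R.le_refl _)
  | a2 φ ψ χ =>
    refine R.imp_eq_one.2 ?_
    change A.le (A.imp _ _) (A.imp (A.imp _ _) (A.imp _ _))
    -- Residuating twice leaves (ψ → χ) · ((φ → ψ) · φ) ≤ χ, which is two applications of x → y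
    -- times x lies below y.
    rw [← R.residuation, R.mul_comm, ← R.residuation, R.mul_assoc]
    generalize A.eval h φ = x, A.eval h ψ = y, A.eval h χ = z
    refine R.le_trans ?_ (R.imp_mul_le y z)
    rw [R.mul_comm, R.mul_comm (A.imp y z)]
    exact R.mul_mono_left _ (R.imp_mul_le x y)
  | a3 φ ψ => exact R.imp_eq_one.2 (R.le_of_eq (R.mul_comm _ _))
  | a4 φ ψ => exact R.imp_eq_one.2 (R.mul_le_right _ _)
  | a5 φ ψ χ => exact R.imp_eq_one.2 (R.le_of_eq (R.imp_imp _ _ _))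
  | a6 φ ψ χ => exact R.imp_eq_one.2 (R.le_of_eq (R.imp_imp _ _ _).symm)
  | a7 φ ψ => exact R.imp_eq_one.2 (R.le_of_eq (hA.divisibility _ _))
  | a8 φ ψ => exact R.imp_eq_one.2 (R.le_of_eq (hA.divisibility _ _).symm)
  | a9 φ ψ => exact R.imp_eq_one.2 (R.le_of_eq (R.meet_comm _ _))
  | a10 φ ψ => exact R.imp_eq_one.2 (R.le_join_left _ _)
  | a11 φ ψ => exact R.imp_eq_one.2 (R.le_join_right _ _)
  | a12 φ ψ χ =>
    refine R.imp_eq_one.2 ((R.residuation _ _ _).1 ?_)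
    change A.le (A.mul _ (A.join _ _)) _
    rw [R.mul_comm, R.join_mul]
    refine R.join_le ?_ ?_ <;> rw [R.mul_comm]
    · exact R.le_trans (R.mul_mono_left _ (R.meet_le_left _ _)) (R.imp_mul_le _ _)
    · exact R.le_trans (R.mul_mono_left _ (R.meet_le_right _ _)) (R.imp_mul_le _ _)
  | a13 φ => exact R.imp_eq_one.2 (R.zero_le _)
  | a14 φ ψ => exact hA.prelinearity _ _
  | a15 φ => exact R.iff_eq_one.2 (hA.neg_neg _)
  | boxK i φ ψ =>
    refine R.imp_eq_one.2 ((R.residuation _ _ _).1 ?_)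
    change A.le (A.mul (A.box i _) (A.box i _)) _
    -- □ is multiplicative and monotone, so □(φ → ψ) · □φ = □((φ → ψ) · φ) ≤ □ψ.
    rw [← hA.box_mul]
    exact hA.box_mono i (R.imp_mul_le _ _)
  | boxP i φ ψ => exact R.iff_eq_one.2 (hA.box_mul i _ _)
  | boxM i φ ψ => exact R.iff_eq_one.2 (hA.box_meet i _ _)
  | boxOne i => exact R.iff_eq_one.2 (hA.box_one i)
  | boxZero i => exact R.iff_eq_one.2 (hA.box_zero i)

/-- Soundness: derivations preserve the value `1`. -/
theorem IsMVI.eval_derives (hA : A.IsMVI) {Ax Γ : Set (Fm I)} {φ : Fm I} (d : Derives Ax Γ φ)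
    (hAx : ∀ φ ∈ Ax, ∀ h, A.eval h φ = A.one) (h : ℕ → A.carrier)
    (hΓ : ∀ γ ∈ Γ, A.eval h γ = A.one) : A.eval h φ = A.one := by
  have R := hA.toIsResiduatedLattice
  induction d with
  | ax h1 => exact hAx _ h1 h
  | hyp h1 => exact hΓ _ h1
  | mp _ _ h1 h2 =>
    have h3 := R.imp_eq_one.1 h2
    rw [h1] at h3
    exact R.le_antisymm (R.le_one _) h3
  | nec i _ h1 => exact (congrArg (A.box i) h1).trans (hA.box_one i)

end Alg

/-! ## Theories and their Lindenbaum algebras -/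

/-- Theories of Ł(I): sets of formulas closed under derivability in Ł(I). -/
structure IsTheory (T : Set (Fm I)) : Prop where
  ax : ∀ {φ}, LukAxiom φ → φ ∈ T
  mp : ∀ {φ ψ}, φ ∈ T → φ.imp ψ ∈ T → ψ ∈ T
  nec : ∀ (i : I) {φ}, φ ∈ T → φ.box i ∈ T

namespace IsTheory

variable {T : Set (Fm I)} (hT : IsTheory T) {φ ψ χ : Fm I}

include hT

-- The preorder of provable implication modulo a theory

theorem refl (φ : Fm I) : φ.imp φ ∈ T := hT.ax (.a1 φ)

theorem trans (h1 : φ.imp ψ ∈ T) (h2 : ψ.imp χ ∈ T) : φ.imp χ ∈ T :=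
  hT.mp h2 (hT.mp h1 (hT.ax (.a2 φ ψ χ)))

theorem residuation : (φ.mul ψ).imp χ ∈ T ↔ φ.imp (ψ.imp χ) ∈ T :=
  ⟨fun h => hT.mp h (hT.ax (.a6 φ ψ χ)), fun h => hT.mp h (hT.ax (.a5 φ ψ χ))⟩

theorem mul_le_left (φ ψ : Fm I) : (φ.mul ψ).imp φ ∈ T :=
  hT.trans (hT.ax (.a3 φ ψ)) (hT.ax (.a4 ψ φ))

theorem weaken (h : φ ∈ T) (ψ : Fm I) : ψ.imp φ ∈ T :=
  hT.mp h (hT.residuation.1 (hT.mul_le_left φ ψ))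

theorem mul_mono_left (χ : Fm I) (h : φ.imp ψ ∈ T) : (φ.mul χ).imp (ψ.mul χ) ∈ T :=
  hT.residuation.2 (hT.trans h (hT.residuation.1 (hT.refl _)))

theorem mul_mono {φ' ψ' : Fm I} (h : φ.imp ψ ∈ T) (h' : φ'.imp ψ' ∈ T) :
    (φ.mul φ').imp (ψ.mul ψ') ∈ T :=
  hT.trans (hT.mul_mono_left φ' h) (hT.trans (hT.ax (.a3 _ _))
    (hT.trans (hT.mul_mono_left ψ h') (hT.ax (.a3 _ _))))

theorem imp_mul_le (φ ψ : Fm I) : ((φ.imp ψ).mul φ).imp ψ ∈ T := hT.residuation.2 (hT.refl _)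

theorem imp_mono {φ' ψ' : Fm I} (h : φ'.imp φ ∈ T) (h' : ψ.imp ψ' ∈ T) :
    (φ.imp ψ).imp (φ'.imp ψ') ∈ T :=
  hT.residuation.1 (hT.trans (hT.mul_mono (hT.refl _) h) (hT.trans (hT.imp_mul_le φ ψ) h'))

theorem meet_le_left (φ ψ : Fm I) : (φ.meet ψ).imp φ ∈ T :=
  hT.trans (hT.ax (.a8 φ ψ)) (hT.mul_le_left _ _)

theorem meet_le_right (φ ψ : Fm I) : (φ.meet ψ).imp ψ ∈ T :=
  hT.trans (hT.ax (.a9 φ ψ)) (hT.meet_le_left _ _)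

theorem mul_mem (h1 : φ ∈ T) (h2 : ψ ∈ T) : φ.mul ψ ∈ T :=
  hT.mp h2 (hT.mp h1 (hT.residuation.1 (hT.refl (φ.mul ψ))))

theorem meet_mem : φ.meet ψ ∈ T ↔ φ ∈ T ∧ ψ ∈ T :=
  ⟨fun h => ⟨hT.mp h (hT.meet_le_left _ _), hT.mp h (hT.meet_le_right _ _)⟩,
    fun h => hT.mp (hT.mul_mem h.1 (hT.weaken h.2 φ)) (hT.ax (.a7 φ ψ))⟩

/-- No axiom introduces ∧ below a hypothesis, so divisibility and commutativity of ∧ do the work: χ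
≤ χ(χ → φ) because χ → φ is in the theory, then χ(χ → φ) ≤ χ ∧ φ ≤ φ ∧ χ ≤ φ(φ → χ), and finally φ(φ
→ χ) ≤ φ(φ → ψ) ≤ φ ∧ ψ. -/
theorem le_meet (h1 : χ.imp φ ∈ T) (h2 : χ.imp ψ ∈ T) : χ.imp (φ.meet ψ) ∈ T := by
  have h3 : χ.imp (χ.mul (χ.imp φ)) ∈ T :=
    hT.mp h1 (hT.residuation.1 (hT.ax (.a3 (χ.imp φ) χ)))
  have h4 : χ.imp (φ.mul (φ.imp χ)) ∈ T :=
    hT.trans h3 (hT.trans (hT.ax (.a7 χ φ)) (hT.trans (hT.ax (.a9 χ φ)) (hT.ax (.a8 φ χ))))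
  exact hT.trans h4 (hT.trans (hT.mul_mono (hT.refl φ) (hT.imp_mono (hT.refl φ) h2))
    (hT.ax (.a7 φ ψ)))

theorem join_le (h1 : φ.imp χ ∈ T) (h2 : ψ.imp χ ∈ T) : (φ.join ψ).imp χ ∈ T :=
  hT.mp (hT.meet_mem.2 ⟨h1, h2⟩) (hT.ax (.a12 φ χ ψ))

theorem meet_mono {φ' ψ' : Fm I} (h : φ.imp ψ ∈ T) (h' : φ'.imp ψ' ∈ T) :
    (φ.meet φ').imp (ψ.meet ψ') ∈ T :=
  hT.le_meet (hT.trans (hT.meet_le_left _ _) h) (hT.trans (hT.meet_le_right _ _) h')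

theorem join_mono {φ' ψ' : Fm I} (h : φ.imp ψ ∈ T) (h' : φ'.imp ψ' ∈ T) :
    (φ.join φ').imp (ψ.join ψ') ∈ T :=
  hT.join_le (hT.trans h (hT.ax (.a10 _ _))) (hT.trans h' (hT.ax (.a11 _ _)))

theorem box_mono (i : I) (h : φ.imp ψ ∈ T) : (φ.box i).imp (ψ.box i) ∈ T :=
  hT.mp (hT.nec i h) (hT.ax (.boxK i φ ψ))

/-- Interderivability modulo a theory. -/
def setoid : Setoid (Fm I) where
  r φ ψ := φ.imp ψ ∈ T ∧ ψ.imp φ ∈ T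
  iseqv :=
    { refl := fun φ => ⟨hT.refl φ, hT.refl φ⟩
      symm := And.symm
      trans := fun h1 h2 => ⟨hT.trans h1.1 h2.1, hT.trans h2.2 h1.2⟩ }

/-- The Lindenbaum algebra of a theory. -/
def lindenbaum : Alg I where
  carrier := Quotient hT.setoid
  meet := Quotient.map₂ .meet fun _ _ h _ _ h' => ⟨hT.meet_mono h.1 h'.1, hT.meet_mono h.2 h'.2⟩
  join := Quotient.map₂ .join fun _ _ h _ _ h' => ⟨hT.join_mono h.1 h'.1, hT.join_mono h.2 h'.2⟩
  mul := Quotient.map₂ .mul fun _ _ h _ _ h' => ⟨hT.mul_mono h.1 h'.1, hT.mul_mono h.2 h'.2⟩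
  imp := Quotient.map₂ .imp fun _ _ h _ _ h' => ⟨hT.imp_mono h.2 h'.1, hT.imp_mono h.1 h'.2⟩
  zero := Quotient.mk _ .zero
  one := Quotient.mk _ .one
  box i := Quotient.map (.box i) fun _ _ h => ⟨hT.box_mono i h.1, hT.box_mono i h.2⟩

/-- The class of a formula in the Lindenbaum algebra. -/
def cls (φ : Fm I) : hT.lindenbaum.carrier := Quotient.mk hT.setoid φ

theorem cls_eq : hT.cls φ = hT.cls ψ ↔ φ.imp ψ ∈ T ∧ ψ.imp φ ∈ T :=
  Quotient.eq (r := hT.setoid)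

theorem cls_eq_one : hT.cls φ = hT.cls .one ↔ φ ∈ T :=
  hT.cls_eq.trans ⟨fun h => hT.mp (hT.ax .top) h.2,
    fun h => ⟨hT.weaken (hT.ax .top) φ, hT.weaken h .one⟩⟩

theorem cls_le : hT.lindenbaum.le (hT.cls φ) (hT.cls ψ) ↔ φ.imp ψ ∈ T := by
  change hT.cls (φ.meet ψ) = hT.cls φ ↔ _
  rw [hT.cls_eq]
  exact ⟨fun h => hT.trans h.2 (hT.meet_le_right _ _),
    fun h => ⟨hT.meet_le_left _ _, hT.le_meet (hT.refl _) h⟩⟩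

theorem cls_eq_of_iff (h : φ.iff ψ ∈ T) : hT.cls φ = hT.cls ψ := hT.cls_eq.2 (hT.meet_mem.1 h)

theorem eval_cls (s : ℕ → Fm I) (φ : Fm I) :
    hT.lindenbaum.eval (fun n => hT.cls (s n)) φ = hT.cls (φ.subst s) := by
  induction φ <;> simp_all [Alg.eval] <;> rfl

/-- Choosing representatives turns an assignment into a substitution; with `eval_cls`, statements
about all assignments reduce to structurality of the logic. -/
theorem exists_subst (h : ℕ → hT.lindenbaum.carrier) : ∃ s : ℕ → Fm I, h = fun n => hT.cls (s n) := by
  choose s hs using fun n => Quotient.exists_rep (h n)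
  exact ⟨s, funext fun n => (hs n).symm⟩

theorem mul_assoc_le (φ ψ χ : Fm I) : ((φ.mul ψ).mul χ).imp (φ.mul (ψ.mul χ)) ∈ T :=
  hT.residuation.2 (hT.residuation.2 (hT.trans (hT.residuation.1 (hT.refl (φ.mul (ψ.mul χ))))
    (hT.ax (.a6 _ _ _))))

theorem le_mul_assoc (φ ψ χ : Fm I) : (φ.mul (ψ.mul χ)).imp ((φ.mul ψ).mul χ) ∈ T :=
  hT.residuation.2 (hT.trans (hT.residuation.1 (hT.residuation.1 (hT.refl ((φ.mul ψ).mul χ))))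
    (hT.ax (.a5 _ _ _)))

theorem lindenbaum_isMVI : hT.lindenbaum.IsMVI where
  meet_comm := by
    rintro ⟨x⟩ ⟨y⟩
    exact hT.cls_eq.2 ⟨hT.ax (.a9 _ _), hT.ax (.a9 _ _)⟩
  meet_assoc := by
    rintro ⟨x⟩ ⟨y⟩ ⟨z⟩
    exact hT.cls_eq.2
      ⟨hT.le_meet (hT.trans (hT.meet_le_left _ _) (hT.meet_le_left _ _))
        (hT.meet_mono (hT.meet_le_right _ _) (hT.refl _)),
      hT.le_meet (hT.meet_mono (hT.refl _) (hT.meet_le_left _ _))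
        (hT.trans (hT.meet_le_right _ _) (hT.meet_le_right _ _))⟩
  join_comm := by
    rintro ⟨x⟩ ⟨y⟩
    exact hT.cls_eq.2 ⟨hT.join_le (hT.ax (.a11 _ _)) (hT.ax (.a10 _ _)),
      hT.join_le (hT.ax (.a11 _ _)) (hT.ax (.a10 _ _))⟩
  join_assoc := by
    rintro ⟨x⟩ ⟨y⟩ ⟨z⟩
    exact hT.cls_eq.2
      ⟨hT.join_le (hT.join_mono (hT.refl _) (hT.ax (.a10 _ _)))
        (hT.trans (hT.ax (.a11 _ _)) (hT.ax (.a11 _ _))),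
      hT.join_le (hT.trans (hT.ax (.a10 _ _)) (hT.ax (.a10 _ _)))
        (hT.join_mono (hT.ax (.a11 _ _)) (hT.refl _))⟩
  meet_join := by
    rintro ⟨x⟩ ⟨y⟩
    exact hT.cls_le.2 (hT.ax (.a10 _ _))
  join_meet := by
    rintro ⟨x⟩ ⟨y⟩
    exact hT.cls_eq.2 ⟨hT.join_le (hT.refl _) (hT.meet_le_left _ _), hT.ax (.a10 _ _)⟩
  zero_le := by
    rintro ⟨x⟩
    exact hT.cls_le.2 (hT.ax (.a13 _))
  le_one := by
    rintro ⟨x⟩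
    exact hT.cls_le.2 (hT.weaken (hT.ax .top) x)
  mul_comm := by
    rintro ⟨x⟩ ⟨y⟩
    exact hT.cls_eq.2 ⟨hT.ax (.a3 _ _), hT.ax (.a3 _ _)⟩
  mul_assoc := by
    rintro ⟨x⟩ ⟨y⟩ ⟨z⟩
    exact hT.cls_eq.2 ⟨hT.mul_assoc_le x y z, hT.le_mul_assoc x y z⟩
  one_mul := by
    rintro ⟨x⟩
    exact hT.cls_eq.2 ⟨hT.ax (.a4 _ _), hT.mp (hT.ax .top) (hT.residuation.1 (hT.refl _))⟩
  residuation := by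
    rintro ⟨x⟩ ⟨y⟩ ⟨z⟩
    exact hT.cls_le.trans (hT.residuation.trans hT.cls_le.symm)
  divisibility := by
    rintro ⟨x⟩ ⟨y⟩
    exact hT.cls_eq.2 ⟨hT.ax (.a7 _ _), hT.ax (.a8 _ _)⟩
  prelinearity := by
    rintro ⟨x⟩ ⟨y⟩
    exact hT.cls_eq_one.2 (hT.ax (.a14 _ _))
  neg_neg := by
    rintro ⟨x⟩
    exact hT.cls_eq_of_iff (hT.ax (.a15 _))
  box_meet := by
    rintro i ⟨x⟩ ⟨y⟩
    exact hT.cls_eq_of_iff (hT.ax (.boxM _ _ _))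
  box_mul := by
    rintro i ⟨x⟩ ⟨y⟩
    exact hT.cls_eq_of_iff (hT.ax (.boxP _ _ _))
  box_zero i := hT.cls_eq_of_iff (hT.ax (.boxZero i))
  box_one i := hT.cls_eq_of_iff (hT.ax (.boxOne i))

end IsTheory

/-- The consequences of a set of formulas in an extension of Ł(I) form a theory. -/
theorem Logic.isTheory {L : Logic I} (hL : Luk I ≤ L) (Γ : Set (Fm I)) :
    IsTheory {φ | L.Entails Γ φ} where
  ax h := hL _ _ (Derives.ax h)
  mp {φ ψ} h1 h2 := by
    refine L.cut (Δ := {φ, φ.imp ψ}) ?_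
      (hL _ _ (Derives.mp (φ := φ) (.hyp (by simp)) (.hyp (by simp))))
    rintro χ (rfl | rfl)
    exacts [h1, h2]
  nec i φ h :=
    L.cut (Δ := {φ}) (by rintro χ rfl; exact h) (hL _ _ (Derives.nec i (.hyp rfl)))

/-! ## The class of models of a logic -/

/-- The MV(I)-algebras in which the finite consequences of `L` preserve the value `1`. -/
def models (L : Logic I) : Set (Alg I) :=
  {A | A.IsMVI ∧ ∀ (Γ : Set (Fm I)) (φ : Fm I), Γ.Finite → L.Entails Γ φ →
    ∀ h : ℕ → A.carrier, (∀ γ ∈ Γ, A.eval h γ = A.one) → A.eval h φ = A.one}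

/-- The restriction to finite Γ in `models` is what makes each rule a quasi-equation, with premises
γ ≈ 1 and conclusion φ ≈ 1. -/
theorem isQuasivariety_models (L : Logic I) : IsQuasivariety (models L) := by
  obtain ⟨Q, hQ⟩ := (isVariety_MV I).isQuasivariety
  refine ⟨Q ∪ {q | ∃ (l : List (Fm I)) (φ : Fm I), L.Entails {γ | γ ∈ l} φ ∧
    q = (l.map fun γ => (γ, .one), (φ, .one))}, ?_⟩
  ext A
  have hA : A.IsMVI ↔ ∀ q ∈ Q, A.SatQuasiEqn q := Set.ext_iff.1 hQ A
  constructor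
  · rintro ⟨h1, h2⟩ q (hq | ⟨l, φ, hl, rfl⟩)
    · exact hA.1 h1 q hq
    · intro h h3
      refine h2 _ φ (List.finite_toSet l) hl h fun γ hγ => ?_
      exact h3 (γ, .one) (List.mem_map.2 ⟨γ, hγ, rfl⟩)
  · intro h
    refine ⟨hA.2 fun q hq => h q (.inl hq), fun Γ φ hΓ hφ a ha => ?_⟩
    have e : {γ | γ ∈ hΓ.toFinset.toList} = Γ := by ext; simp
    refine h _ (.inr ⟨hΓ.toFinset.toList, φ, by rwa [e], rfl⟩) a fun t ht => ?_
    obtain ⟨γ, hγ, rfl⟩ := List.mem_map.1 ht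
    exact ha γ (e ▸ hγ)

/-- Completeness of a finitary extension of Ł(I) with respect to its models. -/
theorem entails_iff_models {L : Logic I} (hf : L.IsFinitary) (hL : Luk I ≤ L) (Γ : Set (Fm I))
    (φ : Fm I) : L.Entails Γ φ ↔ EqConseq (models L) {e | ∃ γ ∈ Γ, e = (γ, .one)} (φ, .one) := by
  constructor
  · intro h A hA a ha
    obtain ⟨Γ₀, h1, h2, h3⟩ := hf Γ φ h
    exact hA.2 Γ₀ φ h2 h3 a fun γ hγ => ha (γ, .one) ⟨γ, h1 hγ, rfl⟩
  · intro h
    have hT := Logic.isTheory hL Γ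
    have e (ψ : Fm I) : hT.lindenbaum.eval (fun n => hT.cls (.var n)) ψ = hT.cls ψ := by
      rw [hT.eval_cls, Formula.subst_var]
    refine hT.cls_eq_one.1 ((e φ).symm.trans (h hT.lindenbaum ⟨hT.lindenbaum_isMVI, ?_⟩ _ ?_))
    -- The Lindenbaum algebra is a model: the assignment is a substitution s, the premises s(δ)
    -- follow from Γ, and so does s(ψ) by structurality and cut.
    · intro Δ ψ _ hψ a ha
      obtain ⟨s, rfl⟩ := hT.exists_subst a
      rw [hT.eval_cls]
      refine hT.cls_eq_one.2 (L.cut ?_ (L.structural s hψ))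
      rintro _ ⟨δ, hδ, rfl⟩
      have h1 := ha δ hδ
      rw [hT.eval_cls] at h1
      exact hT.cls_eq_one.1 h1
    · rintro _ ⟨γ, hγ, rfl⟩
      exact (e γ).trans (hT.cls_eq_one.2 (L.refl hγ))

/-- In MV(I)-algebras an equation `α ≈ β` is equivalent to `α ↔ β ≈ 1`. -/
theorem eqConseq_iff {K : Set (Alg I)} (hK : K ⊆ MV I) (Θ : Set (Eqn I)) (ε δ : Fm I) :
    EqConseq K Θ (ε, δ) ↔
      EqConseq K {e | ∃ γ ∈ {φ | ∃ t ∈ Θ, φ = t.1.iff t.2}, e = (γ, .one)} (ε.iff δ, .one) := by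
  refine forall₂_congr fun A hA => forall_congr' fun h => ?_
  have R : A.IsResiduatedLattice := (hK hA).toIsResiduatedLattice
  refine imp_congr ?_ (R.eval_iff h ε δ).symm
  constructor
  · rintro h1 _ ⟨_, ⟨t, ht, rfl⟩, rfl⟩
    exact (R.eval_iff h _ _).2 (h1 t ht)
  · exact fun h1 t ht => (R.eval_iff h _ _).1 (h1 (_, .one) ⟨_, ⟨t, ht, rfl⟩, rfl⟩)

-- Algebraizability

theorem corresponds_models {L : Logic I} (hf : L.IsFinitary) (hL : Luk I ≤ L) :
    Corresponds L (models L) :=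
  ⟨entails_iff_models hf hL, fun Θ ε δ =>
    (eqConseq_iff (fun _ hA => hA.1) Θ ε δ).trans (entails_iff_models hf hL _ _).symm⟩

theorem toEqns_singleton (Γ : Set (Fm I)) :
    toEqns {(.var 0, .one)} Γ = {e | ∃ γ ∈ Γ, e = (γ, .one)} := by
  ext e
  simp [toEqns, Formula.subst]

theorem toFms_singleton (Θ : Set (Eqn I)) :
    toFms {(Formula.var 0).iff (.var 1)} Θ = {φ | ∃ t ∈ Θ, φ = t.1.iff t.2} := by
  ext φ
  simp [toFms, Formula.subst, Formula.iff]

theorem isEquivAlgSem_models {L : Logic I} (hf : L.IsFinitary) (hL : Luk I ≤ L) :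
    IsEquivAlgSem L (models L) := by
  obtain ⟨h1, h2⟩ := corresponds_models hf hL
  refine ⟨isQuasivariety_models L, {(.var 0, .one)}, {(Formula.var 0).iff (.var 1)},
    Set.finite_singleton _, Set.finite_singleton _, ?_, ?_, ?_, ?_⟩
  · intro Γ φ
    simp only [toEqns_singleton, h1]
    simp
  · intro Θ e
    simp only [toFms_singleton]
    simpa using h2 Θ e.1 e.2
  · intro φ
    simp only [toEqns_singleton, toFms_singleton]
    simp only [h1]
    constructor
    · rintro ψ ⟨_, ⟨γ, rfl, rfl⟩, rfl⟩ A hA h h3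
      exact (hA.1.toIsResiduatedLattice.eval_iff h _ _).2 (h3 (γ, .one) ⟨γ, rfl, rfl⟩)
    · intro A hA h h3
      exact (hA.1.toIsResiduatedLattice.eval_iff h _ _).1
        (h3 (_, .one) ⟨_, ⟨_, ⟨φ, rfl, rfl⟩, rfl⟩, rfl⟩)
  · intro e
    simp only [toEqns_singleton, toFms_singleton]
    constructor
    · rintro _ ⟨_, ⟨t, rfl, rfl⟩, rfl⟩ A hA h h3
      exact (hA.1.toIsResiduatedLattice.eval_iff h _ _).2 (h3 t rfl)
    · intro A hA h h3
      exact (hA.1.toIsResiduatedLattice.eval_iff h _ _).1 (h3 (_, .one) ⟨_, ⟨e, rfl, rfl⟩, rfl⟩)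

/-! ## Uniqueness -/

/-- Each quasi-equation axiomatizing M is itself a consequence over M from a finite list, so it
passes to K. -/
theorem IsQuasivariety.subset_of_eqConseq {K M : Set (Alg I)} (hM : IsQuasivariety M)
    (h : ∀ (l : List (Eqn I)) e, EqConseq M {t | t ∈ l} e → EqConseq K {t | t ∈ l} e) : K ⊆ M := by
  obtain ⟨Q, rfl⟩ := hM
  intro A hA q hq a ha
  exact h q.1 q.2 (fun B hB b hb => hB q hq b hb) A hA a ha

theorem IsQuasivariety.eq_of_eqConseq {K M : Set (Alg I)} (hK : IsQuasivariety K)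
    (hM : IsQuasivariety M) (h : ∀ Θ e, EqConseq K Θ e ↔ EqConseq M Θ e) : K = M :=
  (hM.subset_of_eqConseq fun _ _ => (h _ _).2).antisymm
    (hK.subset_of_eqConseq fun _ _ => (h _ _).1)

/-- The goal is that Δ(ε, δ) and ε ↔ δ are interderivable in L (`hto`, `hfrom`). Then Δ(Θ) ⊢ Δ(ε,
δ), which describes consequence over K, coincides with the condition describing consequence over
`models L`. -/
theorem IsEquivAlgSem.eq_models {L : Logic I} {K : Set (Alg I)} (hf : L.IsFinitary)
    (hL : Luk I ≤ L) (hK : IsEquivAlgSem L K) : K = models L := by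
  obtain ⟨hq, τ, Δ, -, -, hτ, hΔ, hφ, -⟩ := hK
  obtain ⟨c1, c2⟩ := corresponds_models hf hL
  have hrefl (Γ : Set (Fm I)) (ε : Fm I) : L.Entails Γ (ε.iff ε) :=
    (Logic.isTheory hL Γ).meet_mem.2 ⟨hL _ _ (.ax (.a1 ε)), hL _ _ (.ax (.a1 ε))⟩
  have hto (e : Eqn I) : L.Entails (toFms Δ {e}) (e.1.iff e.2) := by
    -- With e = (ε, δ), replacing equals in K takes τ(ε ↔ ε) to τ(ε ↔ δ). Translated by Δ this
    -- becomes Δ(e), Δτ(ε ↔ ε) ⊢ Δτ(ε ↔ δ); the second premise comes from the theorem ε ↔ ε, and the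
    -- conclusion yields ε ↔ δ.
    have h1 (d : Eqn I) (hd : d ∈ toEqns τ {e.1.iff e.2}) :
        EqConseq K ({e} ∪ toEqns τ {e.1.iff e.1}) d := by
      obtain ⟨_, rfl, t, ht, rfl⟩ := hd
      intro A _ h h1
      have h2 : A.eval h e.1 = A.eval h e.2 := h1 e (.inl rfl)
      have h3 := h1 _ (.inr ⟨_, rfl, t, ht, rfl⟩)
      have h4 : (fun x => A.eval h (![e.1.iff e.1] x)) = fun x => A.eval h (![e.1.iff e.2] x) := by
        funext x
        fin_cases x
        simp [Formula.iff, Alg.eval, h2]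
      simpa only [Alg.eval_subst, h4] using h3
    refine L.cut (fun ψ hψ => ?_) (hφ (e.1.iff e.2)).2
    obtain ⟨d, hd, c, hc, rfl⟩ := hψ
    refine L.cut ?_ ((hΔ _ d).1 (h1 d hd) _ ⟨d, rfl, c, hc, rfl⟩)
    rintro _ ⟨t, ht | ht, c', hc', rfl⟩
    · exact L.refl ⟨t, ht, c', hc', rfl⟩
    · refine L.cut ?_ ((hφ (e.1.iff e.1)).1 _ ⟨t, ht, c', hc', rfl⟩)
      rintro _ rfl
      exact hrefl _ _
  have hfrom (e : Eqn I) : ∀ ψ ∈ toFms Δ {e}, L.Entails {e.1.iff e.2} ψ := by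
    rintro _ ⟨t, rfl, d, hd, rfl⟩
    -- Δ(ε, ε) is a theorem because ε ≈ ε holds in K. Given ε ↔ δ, replacing the second argument,
    -- justified over `models L`, yields Δ(ε, δ).
    have h1 : L.Entails ∅ (d.subst ![t.1, t.1]) := by
      have := (hΔ ∅ (t.1, t.1)).1 (fun A _ h _ => rfl) _ ⟨_, rfl, d, hd, rfl⟩
      refine L.mono ?_ this
      rintro _ ⟨_, h, _⟩
      exact h.elim
    have h2 : EqConseq (models L) {t} (d.subst ![t.1, t.1], d.subst ![t.1, t.2]) := by
      intro A _ h h3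
      have h4 := h3 t rfl
      simp only [Alg.eval_subst]
      congr 1
      funext i
      fin_cases i
      · rfl
      · exact h4
    have hT := Logic.isTheory hL {t.1.iff t.2}
    have h3 : L.Entails {t.1.iff t.2} _ := L.mono (by simp) ((c2 _ _ _).1 h2)
    exact hT.mp (L.mono (Set.empty_subset _) h1) (hT.meet_mem.1 h3).1
  refine hq.eq_of_eqConseq (isQuasivariety_models L) fun Θ e => ?_
  rw [hΔ, c2 Θ e.1 e.2]
  have hsub : ∀ t ∈ Θ, toFms Δ {t} ⊆ toFms Δ Θ := by
    rintro t ht _ ⟨_, rfl, d, hd, rfl⟩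
    exact ⟨_, ht, d, hd, rfl⟩
  constructor
  · intro h
    refine L.cut (fun ψ hψ => L.cut ?_ (h ψ hψ)) (hto e)
    rintro _ ⟨t, ht, d, hd, rfl⟩
    exact L.mono (Set.singleton_subset_iff.2 ⟨t, ht, rfl⟩) (hfrom t _ ⟨t, rfl, d, hd, rfl⟩)
  · intro h ψ hψ
    refine L.cut ?_ (hfrom e ψ hψ)
    rintro _ rfl
    refine L.cut ?_ h
    rintro _ ⟨t, ht, rfl⟩
    exact L.mono (hsub t ht) (hto t)

/-! ## The dual isomorphisms -/

theorem models_subset_iff {L M : Logic I} (hf : L.IsFinitary) (hL : Luk I ≤ L)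
    (hf' : M.IsFinitary) (hM : Luk I ≤ M) : models M ⊆ models L ↔ L ≤ M := by
  constructor
  · intro h Γ φ d
    exact (entails_iff_models hf' hM Γ φ).2
      fun A hA => (entails_iff_models hf hL Γ φ).1 d A (h hA)
  · exact fun h A hA => ⟨hA.1, fun Γ φ hΓ d => hA.2 Γ φ hΓ (h _ _ d)⟩

theorem models_hilbert {Ax : Set (Fm I)} (hAx : SubstClosed Ax) :
    models (hilbert Ax hAx) = {A | A.IsMVI ∧ ∀ φ ∈ Ax, ∀ h, A.eval h φ = A.one} := by
  ext A
  constructor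
  · rintro ⟨h1, h2⟩
    exact ⟨h1, fun φ hφ h => h2 ∅ φ Set.finite_empty (Derives.ax hφ) h (by simp)⟩
  · rintro ⟨h1, h2⟩
    exact ⟨h1, fun Γ φ _ d h hΓ => h1.eval_derives d h2 h hΓ⟩

/-- Validity under all assignments is already closed under substitution, so checking S covers all
its instances. -/
theorem models_axiomaticExt (S : Set (Fm I)) :
    models (axiomaticExt S) = MV I ∩ {A | ∀ φ ∈ S, A.SatEqn (φ, .one)} := by
  refine (models_hilbert _).trans ?_
  ext A
  refine and_congr_right fun hA => ⟨fun h φ hφ a => ?_, ?_⟩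
  · exact h φ (.inr ⟨φ, hφ, .var, (Formula.subst_var φ).symm⟩) a
  · rintro h _ (hφ | ⟨φ, hφ, s, rfl⟩) a
    · exact hA.eval_lukAxiom hφ a
    · rw [Alg.eval_subst]
      exact h φ hφ _

theorem isVariety_models_axiomaticExt (S : Set (Fm I)) : IsVariety (models (axiomaticExt S)) := by
  obtain ⟨E, hE⟩ := isVariety_MV I
  refine ⟨E ∪ (fun φ => (φ, .one)) '' S, ?_⟩
  rw [models_axiomaticExt, hE]
  ext A
  simp [or_imp, forall_and]

/-- The finitary logic of a class of MV(I)-algebras. -/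
def logicOf (K : Set (Alg I)) : Logic I where
  Entails Γ φ := ∃ Γ₀ ⊆ Γ, Γ₀.Finite ∧ EqConseq K {e | ∃ γ ∈ Γ₀, e = (γ, .one)} (φ, .one)
  refl {Γ φ} h := ⟨{φ}, by simpa using h, Set.finite_singleton _,
    fun A _ a ha => ha (φ, .one) ⟨φ, rfl, rfl⟩⟩
  mono := fun h ⟨Γ₀, h1, h2, h3⟩ => ⟨Γ₀, h1.trans h, h2, h3⟩
  cut := by
    rintro Γ Δ φ h ⟨Δ₀, h1, h2, h3⟩
    choose! f hf1 hf2 hf3 using h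
    refine ⟨⋃ ψ ∈ Δ₀, f ψ, Set.iUnion₂_subset fun ψ hψ => hf1 ψ (h1 hψ),
      h2.biUnion fun ψ hψ => hf2 ψ (h1 hψ), fun A hA a ha => h3 A hA a ?_⟩
    rintro _ ⟨ψ, hψ, rfl⟩
    refine hf3 ψ (h1 hψ) A hA a ?_
    rintro _ ⟨γ, hγ, rfl⟩
    exact ha _ ⟨γ, Set.mem_biUnion hψ hγ, rfl⟩
  structural := by
    rintro Γ φ s ⟨Γ₀, h1, h2, h3⟩
    refine ⟨_, Set.image_mono h1, h2.image _, fun A hA a ha => ?_⟩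
    refine (A.eval_subst a s φ).trans (h3 A hA _ ?_)
    rintro _ ⟨γ, hγ, rfl⟩
    exact (A.eval_subst a s γ).symm.trans (ha _ ⟨_, ⟨γ, hγ, rfl⟩, rfl⟩)

theorem logicOf_isFinitary (K : Set (Alg I)) : (logicOf K).IsFinitary :=
  fun _ _ ⟨Γ₀, h1, h2, h3⟩ => ⟨Γ₀, h1, h2, Γ₀, subset_rfl, h2, h3⟩

theorem luk_le_logicOf {K : Set (Alg I)} (hK : K ⊆ MV I) : Luk I ≤ logicOf K := by
  intro Γ φ d
  obtain ⟨Γ₀, h1, h2, h3⟩ := Derives.finitary d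
  refine ⟨Γ₀, h1, h2, fun A hA a ha => ?_⟩
  exact (hK hA).eval_derives h3 (fun φ hφ => (hK hA).eval_lukAxiom hφ) a
    fun γ hγ => ha (γ, .one) ⟨γ, hγ, rfl⟩

theorem models_logicOf {K : Set (Alg I)} (hK : IsQuasivariety K) (hKM : K ⊆ MV I) :
    models (logicOf K) = K := by
  apply Set.Subset.antisymm
  · refine hK.subset_of_eqConseq fun l e h => ?_
    refine (corresponds_models (logicOf_isFinitary K) (luk_le_logicOf hKM)).2 _ e.1 e.2 |>.2 ?_
    -- The translated premises form a finite set, so the whole set serves as the finite subset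
    -- required by `logicOf`.
    refine ⟨_, subset_rfl, ?_, (eqConseq_iff hKM _ e.1 e.2).1 h⟩
    refine ((List.finite_toSet l).image fun t => t.1.iff t.2).subset ?_
    rintro _ ⟨t, ht, rfl⟩
    exact ⟨t, ht, rfl⟩
  · intro A hA
    refine ⟨hKM hA, ?_⟩
    rintro Γ φ - ⟨Γ₀, h1, -, h3⟩ a ha
    refine h3 A hA a ?_
    rintro _ ⟨γ, hγ, rfl⟩
    exact ha γ (h1 hγ)

theorem models_axiomaticExt_iff {V : Set (Alg I)} {E : Set (Eqn I)}
    (hV : V = {A | ∀ e ∈ E, A.SatEqn e}) (hVM : V ⊆ MV I) :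
    models (axiomaticExt ((fun e : Eqn I => e.1.iff e.2) '' E)) = V := by
  rw [models_axiomaticExt]
  ext A
  have key (hA : A ∈ MV I) : A ∈ V ↔ ∀ φ ∈ (fun e : Eqn I => e.1.iff e.2) '' E,
      A.SatEqn (φ, .one) := by
    rw [hV, Set.forall_mem_image]
    exact forall₂_congr fun e _ => forall_congr' fun h =>
      (hA.toIsResiduatedLattice.eval_iff h _ _).symm
  exact ⟨fun h => (key h.1).2 h.2, fun h => ⟨hVM h, (key (hVM h)).1 h⟩⟩

/-- The dual isomorphism between finitary extensions and subquasivarieties. -/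
noncomputable def finExtIso (I : Type u) : FinExt I ≃o (SubQuasivariety I)ᵒᵈ :=
  RelIso.ofSurjective
    (OrderEmbedding.ofMapLEIff
      (fun L : FinExt I => OrderDual.toDual
        (⟨models L.1, isQuasivariety_models L.1, fun _ hA => hA.1⟩ : SubQuasivariety I))
      fun L M => models_subset_iff L.2.1 L.2.2 M.2.1 M.2.2)
    fun K => ⟨⟨logicOf (OrderDual.ofDual K).1, logicOf_isFinitary _,
      luk_le_logicOf (OrderDual.ofDual K).2.2⟩,
      congrArg OrderDual.toDual (Subtype.ext
        (models_logicOf (OrderDual.ofDual K).2.1 (OrderDual.ofDual K).2.2))⟩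

/-- The dual isomorphism between axiomatic extensions and subvarieties. -/
noncomputable def axExtIso (I : Type u) : AxExt I ≃o (SubVariety I)ᵒᵈ :=
  RelIso.ofSurjective
    (OrderEmbedding.ofMapLEIff
      (fun L : AxExt I => OrderDual.toDual
        (⟨models L.1, by obtain ⟨L, S, rfl⟩ := L; exact isVariety_models_axiomaticExt S,
          fun _ hA => hA.1⟩ : SubVariety I))
      fun L M => models_subset_iff L.toFinExt.2.1 L.toFinExt.2.2 M.toFinExt.2.1 M.toFinExt.2.2)
    fun K => by
      obtain ⟨V, ⟨E, hE⟩, hV⟩ := K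
      exact ⟨⟨_, _, rfl⟩, congrArg OrderDual.toDual (Subtype.ext (models_axiomaticExt_iff hE hV))⟩

/-! ## The logics Ł(I), S4Ł(I) and S4ₜŁ -/

theorem models_luk (I : Type u) : models (lukExt I).1 = MV I :=
  (models_hilbert substClosed_luk).trans
    (Set.ext fun _ => ⟨fun h => h.1, fun h => ⟨h, fun _ hφ => h.eval_lukAxiom hφ⟩⟩)

/-- Monotonicity of □ is automatic from preservation of ∧. The axiom □φ → □□φ gives one half of
idempotence, and □φ → φ at □φ gives the other. -/
theorem Alg.IsMVI.isS4MVI_iff {A : Alg I} (hA : A.IsMVI) :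
    A.IsS4MVI ↔ ∀ φ, S4Axiom φ → ∀ h, A.eval h φ = A.one := by
  have R := hA.toIsResiduatedLattice
  constructor
  · rintro hS φ (⟨i, ψ⟩ | ⟨i, ψ⟩) h
    · exact R.imp_eq_one.2 (hS.box_le _ _)
    · exact R.imp_eq_one.2 (R.le_of_eq (hS.box_box i _).symm)
  · intro H
    have T (i x) : A.le (A.box i x) x := R.imp_eq_one.1 (H _ (.boxT i (.var 0)) fun _ => x)
    exact
      { hA with
        box_mono := fun i _ _ => hA.box_mono i
        box_le := T
        box_box := fun i x => R.le_antisymm (T i _)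
          (R.imp_eq_one.1 (H _ (.box4 i (.var 0)) fun _ => x)) }

theorem models_s4Luk (I : Type u) : models (s4Luk I).1 = S4MV I := by
  refine (models_hilbert (substClosed_luk.union substClosed_s4)).trans
    (Set.ext fun A => ⟨fun ⟨h1, h2⟩ => ?_, fun h => ?_⟩)
  · exact h1.isS4MVI_iff.2 fun φ hφ => h2 φ (.inr hφ)
  · refine ⟨h.toIsMVI, ?_⟩
    rintro φ (hφ | hφ)
    · exact h.toIsMVI.eval_lukAxiom hφ
    · exact h.toIsMVI.isS4MVI_iff.1 h φ hφ

/-- With P = ¬H¬, residuation says that P is left adjoint to G. The first tense axiom is the unit x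
≤ GPx; the second, contraposed, is the counit PGy ≤ y. -/
theorem Alg.IsS4MVI.isS4tMV_iff {A : Alg Tense.{u}} (hA : A.IsS4MVI) :
    A.IsS4tMV ↔ ∀ φ, TenseAxiom φ → ∀ h, A.eval h φ = A.one := by
  have R := hA.toIsResiduatedLattice
  have N {x y : A.carrier} (h : A.le x y) : A.le (A.neg y) (A.neg x) := R.imp_anti_left _ h
  constructor
  · rintro hS φ (⟨ψ⟩ | ⟨ψ⟩) h
    · exact R.imp_eq_one.2 ((hS.residual _ _).2 (R.le_refl _))
    · refine R.imp_eq_one.2 ?_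
      -- The counit at ¬ψ is ¬H¬G¬ψ ≤ ¬ψ; negating it and cancelling double negations gives ψ ≤
      -- H¬G¬ψ.
      have h1 := N ((hS.residual _ (A.neg (A.eval h ψ))).1 (R.le_refl _))
      rw [hA.neg_neg, hA.neg_neg] at h1
      exact h1
  · intro H
    have gp (x) : A.le x (A.box .G (A.neg (A.box .H (A.neg x)))) :=
      R.imp_eq_one.1 (H _ (.gp (.var 0)) fun _ => x)
    have hf (x) : A.le x (A.box .H (A.neg (A.box .G (A.neg x)))) :=
      R.imp_eq_one.1 (H _ (.hf (.var 0)) fun _ => x)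
    refine { hA with residual := fun x y => ⟨fun h => ?_, fun h => ?_⟩ }
    -- The second axiom at ¬y, negated, is PGy ≤ y; combined with Px ≤ PGy, from x ≤ Gy, it gives Px
    -- ≤ y.
    · have h1 := N (hf (A.neg y))
      rw [hA.neg_neg] at h1
      exact R.le_trans (N (hA.box_mono _ _ _ (N h))) h1
    · exact R.le_trans (gp x) (hA.box_mono _ _ _ h)

theorem models_s4tLuk : models s4tLuk.{u}.1 = S4tMV.{u} := by
  refine (models_hilbert ((substClosed_luk.union substClosed_s4).union substClosed_tense)).trans
    (Set.ext fun A => ⟨fun ⟨h1, h2⟩ => ?_, fun h => ?_⟩)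
  · exact (h1.isS4MVI_iff.2 fun φ hφ => h2 φ (.inl (.inr hφ))).isS4tMV_iff.2
      fun φ hφ => h2 φ (.inr hφ)
  · refine ⟨h.toIsMVI, ?_⟩
    rintro φ ((hφ | hφ) | hφ)
    · exact h.toIsMVI.eval_lukAxiom hφ
    · exact h.toIsMVI.isS4MVI_iff.1 h.toIsS4MVI φ hφ
    · exact h.toIsS4MVI.isS4tMV_iff.1 h φ hφ

theorem isEquivAlgSem_and_corresponds (L : FinExt I) {K : Set (Alg I)} (h : models L.1 = K) :
    IsEquivAlgSem L.1 K ∧ Corresponds L.1 K :=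
  h ▸ ⟨isEquivAlgSem_models L.2.1 L.2.2, corresponds_models L.2.1 L.2.2⟩

end ModalLukasiewicz

theorem mainTheorem6 (I : Type u) :
    -- the dual lattice isomorphisms
    (∃ (Φ : FinExt I ≃o (SubQuasivariety I)ᵒᵈ) (Ψ : AxExt I ≃o (SubVariety I)ᵒᵈ),
      -- `Ψ` is the restriction of `Φ`
      (∀ L : AxExt I,
        (OrderDual.ofDual (Ψ L)).1 = (OrderDual.ofDual (Φ L.toFinExt)).1) ∧
      -- `Φ L` is the (unique) equivalent algebraic semantics of `L`
      (∀ (L : FinExt I) (K : Set (Alg I)),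
        IsEquivAlgSem L.1 K ↔ K = (OrderDual.ofDual (Φ L)).1)) ∧
    -- derivability and equational consequence
    (∀ (L : FinExt I) (K : Set (Alg I)), IsEquivAlgSem L.1 K → Corresponds L.1 K) ∧
    -- in particular, for Ł(I), S4Ł(I), S4Ł and S4ₜŁ
    (IsEquivAlgSem (lukExt I).1 (MV I) ∧ Corresponds (lukExt I).1 (MV I)) ∧
    (IsEquivAlgSem (s4Luk I).1 (S4MV I) ∧ Corresponds (s4Luk I).1 (S4MV I)) ∧
    (IsEquivAlgSem (s4Luk PUnit.{u + 1}).1 (S4MV PUnit.{u + 1}) ∧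
      Corresponds (s4Luk PUnit.{u + 1}).1 (S4MV PUnit.{u + 1})) ∧
    (IsEquivAlgSem s4tLuk.{u}.1 S4tMV.{u} ∧ Corresponds s4tLuk.{u}.1 S4tMV.{u}) := by
  -- Both isomorphisms send a logic to its `models`, so the restriction claim holds by definition.
  refine ⟨⟨finExtIso I, axExtIso I, fun L => rfl, fun L K => ⟨fun h => h.eq_models L.2.1 L.2.2, ?_⟩⟩,
    fun L K h => ?_, isEquivAlgSem_and_corresponds _ (models_luk I),
    isEquivAlgSem_and_corresponds _ (models_s4Luk I),
    isEquivAlgSem_and_corresponds _ (models_s4Luk _),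
    isEquivAlgSem_and_corresponds _ models_s4tLuk⟩
  · rintro rfl
    exact isEquivAlgSem_models L.2.1 L.2.2
  · rw [h.eq_models L.2.1 L.2.2]
    exact corresponds_models L.2.1 L.2.2
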